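/- Let $L,T,h>0$, $\alpha\in\mathbb R$, $\beta>0$ satisfy the gain condition $0<2\alpha^2+\tfrac32\beta<\tfrac12$. Put $X_0=[L^2(0,L)]^2$ and $H=X_0\times L^2(0,1)$, with squared norm $\|(u,v,z)\|_H^2=\|(u,v)\|_{X_0}^2+\beta h\|z\|_{L^2(0,1)}^2$, and $\mathcal B=C([0,T],X_0)\cap L^2(0,T;[H^1(0,L)]^2)$ with norm $\sup_{t\in[0,T]}\|(u(t),v(t))\|_{X_0}+\|(u_x,v_x)\|_{L^2(0,T;X_0)}$. Let $A(u,v,z)=(\tfrac12u_{xxx},\,-v_{xxx},\,-\tfrac1h z_\rho)$ be the operator in $H$ whose domain $D(A)$ consists of all $(u,v,z)$ with $u,v\in H^3(0,L)\cap H_0^1(0,L)$, $z\in H^1(0,1)$, $u_x(0)=0$, $z(0)=u_x(L)$ and $v_x(L)=\alpha u_x(L)+\beta z(1)$. For every $U_0=(u_0,v_0,z_0)\in H$ there is exactly one mild solution $U=(u,v,z)\in C([0,T],H)$ of $U'=AU$, $U(0)=U_0$, that is, one $U$ such that $\int_0^tU(s)\,ds\in D(A)$ and $U(t)=U_0+A\int_0^tU(s)\,ds$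 for all $t\in[0,T]$. Moreover $(u,v)\in\mathcal B$, and the map $$H\to\mathcal B\times C([0,T],L^2(0,1)),\qquad (u_0,v_0,z_0)\mapsto(u,v,z)$$ is continuous. The solution satisfies 1. (energy bound) $\|(u(t),v(t))\|_{X_0}^2+\beta h\|z(t)\|_{L^2(0,1)}^2\le\|(u_0,v_0)\|_{X_0}^2+\beta h\|z_0\|_{L^2(0,1)}^2$ for all $t\in[0,T]$; 2. (boundary traces) the traces $u_x(\cdot,L)$ and $z(\cdot,1)$ exist in $L^2(0,T)$, in the sense that $\partial_x\!\left(\int_0^tu(s)\,ds\right)(L)=\int_0^tu_x(s,L)\,ds$ and $\left(\int_0^tz(s)\,ds\right)(1)=\int_0^tz(s,1)\,ds$ for all $t\in[0,T]$, and $$\|u_x(\cdot,L)\|_{L^2(0,T)}^2+\|z(\cdot,1)\|_{L^2(0,T)}^2\le 4\|(u_0,v_0)\|_{X_0}^2+h\|z_0\|_{L^2(0,1)}^2;$$ 3. (Kato smoothing) $$\int_0^T\!\!\int_0^L\left(u_x^2+v_x^2\right)dx\,dt\le\tfrac43L(1+\alpha^2+\beta^2)\left(\|(u_0,v_0)\|_{X_0}^2+\beta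 h\|z_0\|_{L^2(0,1)}^2\right).$$ -/

import Mathlib

open MeasureTheory Set
open scoped ContDiff

noncomputable section

namespace HirotaSatsuma

/-- The real Hilbert space `L²(0,a)`. -/
abbrev L2 (a : ℝ) : Type := Lp ℝ 2 (volume.restrict (Ioo (0 : ℝ) a))

/-- `X₀ = [L²(0,L)]²` with its Hilbert norm `‖(u,v)‖² = ‖u‖² + ‖v‖²`. -/
abbrev X0 (L : ℝ) : Type := WithLp 2 (L2 L × L2 L)

/-- The state space `H = X₀ × L²(0,1)` as a topological vector space. Its weighted Hilbert norm
is given by `normSqH` below, and is equivalent to the norm of the product. -/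
abbrev H (L : ℝ) : Type := X0 L × L2 1

/-- The square of the norm of `H`, which comes from the inner product
`⟨(u,v),(u',v')⟩_{X₀} + β h ⟨z,z'⟩_{L²(0,1)}`. -/
def normSqH {L : ℝ} (h β : ℝ) (U : H L) : ℝ := ‖U.1‖ ^ 2 + β * h * ‖U.2‖ ^ 2

/-- `g ∈ L²(0,a)` is the weak derivative of `f ∈ L²(0,a)`. Hence `f ∈ H¹(0,a)` iff
`∃ g, HasWeakDeriv a f g`. -/
def HasWeakDeriv (a : ℝ) (f g : L2 a) : Prop :=
  ∀ φ : ℝ → ℝ, ContDiff ℝ ∞ φ → HasCompactSupport φ → tsupport φ ⊆ Ioo 0 a →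
    ∫ x in Ioo 0 a, f x * deriv φ x = -∫ x in Ioo 0 a, g x * φ x

/-- `f ∈ L²(0,a)` has a representative that is continuous on `[0,a]`, and its value at
`x ∈ [0,a]` is `c`. -/
def HasTrace (a : ℝ) (f : L2 a) (x c : ℝ) : Prop :=
  ∃ F : ℝ → ℝ, ContinuousOn F (Icc 0 a) ∧
    (f : ℝ → ℝ) =ᵐ[volume.restrict (Ioo (0 : ℝ) a)] F ∧ F x = c

/-- The graph of the unbounded operator `A (u,v,z) = (½ u_xxx, -v_xxx, -(1/h) z_ρ)` of `H` with
domain: `u, v ∈ H³(0,L) ∩ H¹₀(0,L)`, `z ∈ H¹(0,1)`, `u_x(0) = 0`, `z(0) = u_x(L)`,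
`v_x(L) = α u_x(L) + β z(1)`. The proposition says: `U = (u,v,z) ∈ D(A)` and `A U = F`.
Here `p = u_x(L) = z(0)` and `q = z(1)`. -/
def IsA {L : ℝ} (h α β : ℝ) (U F : H L) : Prop :=
  ∃ (u₁ u₂ u₃ v₁ v₂ v₃ : L2 L) (z₁ : L2 1) (p q : ℝ),
    (HasWeakDeriv L U.1.fst u₁ ∧ HasWeakDeriv L u₁ u₂ ∧ HasWeakDeriv L u₂ u₃) ∧
    (HasWeakDeriv L U.1.snd v₁ ∧ HasWeakDeriv L v₁ v₂ ∧ HasWeakDeriv L v₂ v₃) ∧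
    HasWeakDeriv 1 U.2 z₁ ∧
    (HasTrace L U.1.fst 0 0 ∧ HasTrace L U.1.fst L 0) ∧
    (HasTrace L U.1.snd 0 0 ∧ HasTrace L U.1.snd L 0) ∧
    HasTrace L u₁ 0 0 ∧
    (HasTrace L u₁ L p ∧ HasTrace 1 U.2 0 p) ∧
    (HasTrace 1 U.2 1 q ∧ HasTrace L v₁ L (α * p + β * q)) ∧
    F = (WithLp.toLp 2 ((1 / 2 : ℝ) • u₃, -v₃), -((1 / h) • z₁))

/-- `U ∈ C([0,T], H)` is the mild solution of `U' = A U`, `U(0) = U₀`: for every `t ∈ [0,T]`,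
`∫₀ᵗ U(s) ds ∈ D(A)` and `U(t) = U₀ + A ∫₀ᵗ U(s) ds`. -/
def IsMildSolution {L T : ℝ} (hT : 0 ≤ T) (h α β : ℝ) (U₀ : H L) (U : C(Icc (0 : ℝ) T, H L)) :
    Prop :=
  ∀ t ∈ Icc 0 T, IsA h α β (∫ s in (0 : ℝ)..t, IccExtend hT U s) (IccExtend hT U t - U₀)

/-- The space `𝓑 = C([0,T], X₀) ∩ L²(0,T; [H¹(0,L)]²)`. An element `(u,v)` is stored together
with its (unique) spatial derivative `(u_x,v_x) ∈ L²(0,T; X₀)`, so that the topology is the one of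
the norm `sup_t ‖(u(t),v(t))‖_{X₀} + ‖(u_x,v_x)‖_{L²(0,T;X₀)}`. -/
abbrev BSpace (L T : ℝ) : Type :=
  {w : C(Icc (0 : ℝ) T, X0 L) × Lp (X0 L) 2 (volume.restrict (Ioo (0 : ℝ) T)) //
    ∀ᵐ t ∂(volume.restrict (Ioo (0 : ℝ) T)), ∀ ht : t ∈ Icc (0 : ℝ) T,
      HasWeakDeriv L (w.1 ⟨t, ht⟩).fst (w.2 t).fst ∧
      HasWeakDeriv L (w.1 ⟨t, ht⟩).snd (w.2 t).snd}

/-- The path `t ↦ (u(t), v(t))` in `X₀`. -/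
def BSpace.path {L T : ℝ} (w : BSpace L T) : C(Icc (0 : ℝ) T, X0 L) := w.1.1

/-- The derivative `(u_x, v_x) ∈ L²(0,T; X₀)`. -/
def BSpace.dx {L T : ℝ} (w : BSpace L T) : Lp (X0 L) 2 (volume.restrict (Ioo (0 : ℝ) T)) := w.1.2

/-- `g = u_x(·,L)` in `L²(0,T)` for the first component `u` of a path in `H`, that is,
`∂ₓ(∫₀ᵗ u(s) ds)(L) = ∫₀ᵗ g(s) ds` for every `t ∈ [0,T]`. A mild solution takes values in `H`
only, but `∫₀ᵗ U(s) ds ∈ D(A)`, so that the left-hand side is an ordinary trace. There is at most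
one such `g`, and it is the pointwise trace where `U` is continuous with values in `D(A)`. -/
def IsTraceUx {L T : ℝ} (hT : 0 ≤ T) (U : C(Icc (0 : ℝ) T, H L))
    (g : Lp ℝ 2 (volume.restrict (Ioo (0 : ℝ) T))) : Prop :=
  ∀ t ∈ Icc 0 T, ∃ p : L2 L, HasWeakDeriv L (∫ s in (0 : ℝ)..t, IccExtend hT U s).1.fst p ∧
    HasTrace L p L (∫ s in (0 : ℝ)..t, g s)

/-- `g = z(·,1)` in `L²(0,T)` for the third component `z` of a path in `H`, in the same sense:
`(∫₀ᵗ z(s) ds)(1) = ∫₀ᵗ g(s) ds` for every `t ∈ [0,T]`. -/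
def IsTraceZ {L T : ℝ} (hT : 0 ≤ T) (U : C(Icc (0 : ℝ) T, H L))
    (g : Lp ℝ 2 (volume.restrict (Ioo (0 : ℝ) T))) : Prop :=
  ∀ t ∈ Icc 0 T, HasTrace 1 (∫ s in (0 : ℝ)..t, IccExtend hT U s).2 1 (∫ s in (0 : ℝ)..t, g s)

end HirotaSatsuma

end

open HirotaSatsuma

/-!
The operator `A` is invertible: `A (u,v,z) = F` is solved by integrating `F` and adjusting
constants of integration, so `A⁻¹` is a bounded operator `invA` of `H`, built from the primitive
operator of `L²(0,a)`. By du Bois-Reymond's lemma the graph `IsA` of `A` is exactly the set of pairs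
`(invA F, F)` (`isA_invA`, `eq_invA_of_isA`), and the traces `u_x(L)`, `z(1)` and the derivatives
`(u_x,v_x)` of `invA F` are bounded linear functions of `F`. All identities obtained from the
multipliers `1` and `x` then become identities between bounded operators. They reduce to
`⟨If,g⟩ + ⟨f,Ig⟩ = (∫f)(∫g)` and `xI = Ix + I²` for the primitive operator `I`. In particular the
gain condition makes `A` dissipative for the weighted inner product (`inner_invA_nonpos`).

Existence is proved for any injective bounded dissipative operator `K` of a Hilbert space, with
`K = A⁻¹` in the application. The equation `W = K W'` is regularized to `D = (K - ε) D'`, where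
`K - ε` is invertible by the Lax-Milgram theorem. The regularized solutions form a Cauchy family as
`ε → 0`, because `D'` does not grow, and the limit is a mild solution with initial value `K y`
(`exists_mild_of_dissipative`). If `D` is a mild solution with `D(0) = K y`, then `K D` is a
classical solution with initial value `K² y`; since `K` has dense range, these initial values are
dense.

For a classical solution `U = A⁻¹ V`, `V = U'`, the energy bound, the trace bound and the smoothing
estimate follow by integrating the multiplier identities in time. With `p = u_x(·,L)` and
`q = z(·,1)`, the multiplier `1` gives `½ ∫ p² ≤ ‖u₀‖²` and `∫ q² ≤ ∫ p² + h ‖z₀‖²`, the multiplier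
`L - x` gives `3/2 ∫ ‖u_x‖² ≤ L ‖u₀‖²`, and the multiplier `x` gives
`3 ∫ ‖v_x‖² ≤ L ∫ (α p + β q)² + L ‖v₀‖²`.

The closure of the space of classical solutions, taken together with their traces and derivatives,
is the space `solutions`. The three estimates, the mild equation, the meaning of the traces and of
the derivatives are closed conditions and hold on the closure. The estimates bound an element of
`solutions` by its initial value, so that taking initial values is a bijection of `solutions` onto
`H` with Lipschitz inverse (`exists_solution_operator`). Uniqueness holds because the integral of
the difference of two mild solutions is a solution of `W = A⁻¹ W'` with zero initial value.
-/

noncomputable section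

namespace HirotaSatsuma

open scoped RealInnerProductSpace

/-! ### Primitives and multiplication by `x` on `L²(0,a)` -/

section

/-- The indicator function of `(0,x)` in `L²(0,a)`. -/
def ind (a x : ℝ) : L2 a :=
  indicatorConstLp 2 (measurableSet_Ioo : MeasurableSet (Ioo 0 x)) (measure_ne_top _ _) 1

/-- The functional `f ↦ ∫₀ˣ f` on `L²(0,a)`. -/
def integralTo (a x : ℝ) : L2 a →L[ℝ] ℝ := innerSL ℝ (ind a x)

/-- The constant function `1` in `L²(0,a)`. -/
def one (a : ℝ) : L2 a := ind a a

theorem integralTo_eq_inner {a : ℝ} (f : L2 a) : integralTo a a f = ⟪one a, f⟫ := rfl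

variable {a : ℝ}

theorem coeFn_one : (one a : ℝ → ℝ) =ᵐ[volume.restrict (Ioo (0 : ℝ) a)] fun _ => 1 := by
  filter_upwards [indicatorConstLp_coeFn (p := 2) (μ := volume.restrict (Ioo (0 : ℝ) a))
    (hs := (measurableSet_Ioo : MeasurableSet (Ioo 0 a))) (hμs := measure_ne_top _ _)
    (c := (1 : ℝ)),
    ae_restrict_mem measurableSet_Ioo] with x hx hxa
  rw [one, ind, hx, indicator_of_mem hxa]

theorem intervalIntegrable_L2 (f : L2 a) {x y : ℝ} (hx : x ∈ Icc 0 a) (hy : y ∈ Icc 0 a) :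
    IntervalIntegrable f volume x y := by
  have h1 : IntegrableOn f (Ioo 0 a) :=
    (Lp.memLp f).integrable (by norm_num)
  have h2 : IntegrableOn f (Icc 0 a) :=
    (integrableOn_Icc_iff_integrableOn_Ioo (by simp) (by simp)).2 h1
  exact (h2.mono_set (uIcc_subset_Icc hx hy)).intervalIntegrable

theorem integralTo_apply (f : L2 a) {x : ℝ} (hx : x ∈ Icc 0 a) :
    integralTo a x f = ∫ s in (0 : ℝ)..x, f s := by
  have h : integralTo a x f = ∫ s in Ioo 0 x, f s ∂(volume.restrict (Ioo 0 a)) :=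
    L2.inner_indicatorConstLp_one _ _ _
  rw [h, Measure.restrict_restrict measurableSet_Ioo, Ioo_inter_Ioo,
    intervalIntegral.integral_of_le hx.1, integral_Ioc_eq_integral_Ioo]
  simp [hx.2]

theorem continuousOn_integralTo (f : L2 a) :
    ContinuousOn (fun x => integralTo a x f) (Icc 0 a) := by
  rcases lt_or_ge a 0 with ha | ha
  · simp [Icc_eq_empty (not_le.2 ha)]
  have h := (intervalIntegrable_L2 f (left_mem_Icc.2 ha) (right_mem_Icc.2 ha))
  have h2 := intervalIntegral.continuousOn_primitive_interval' h (left_mem_uIcc)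
  rw [uIcc_of_le ha] at h2
  exact h2.congr fun x hx => integralTo_apply f hx

theorem norm_ind_le (x : ℝ) : ‖ind a x‖ ≤ (volume.restrict (Ioo 0 a)).real univ ^ (1 / 2 : ℝ) := by
  refine norm_indicatorConstLp_le.trans ?_
  simp only [norm_one, one_mul, ENNReal.toReal_ofNat]
  exact Real.rpow_le_rpow (by positivity) (measureReal_mono (subset_univ _)) (by norm_num)

theorem abs_integralTo_le (f : L2 a) (x : ℝ) :
    ‖integralTo a x f‖ ≤ (volume.restrict (Ioo 0 a)).real univ ^ (1 / 2 : ℝ) * ‖f‖ :=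
  (norm_inner_le_norm _ _).trans (mul_le_mul_of_nonneg_right (norm_ind_le x) (norm_nonneg _))

theorem memLp_integralTo (f : L2 a) :
    MemLp (fun x => integralTo a x f) 2 (volume.restrict (Ioo 0 a)) :=
  MemLp.of_bound (((continuousOn_integralTo f).mono Ioo_subset_Icc_self).aestronglyMeasurable
    measurableSet_Ioo) _ (ae_of_all _ fun x => abs_integralTo_le f x)

/-- The primitive `f ↦ (x ↦ ∫₀ˣ f)` as a bounded operator of `L²(0,a)`. -/
def primitive (a : ℝ) : L2 a →L[ℝ] L2 a :=
  LinearMap.mkContinuous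
    { toFun := fun f => (memLp_integralTo f).toLp _
      map_add' := fun f g => by
        rw [← MemLp.toLp_add]; exact MemLp.toLp_congr _ _ (ae_of_all _ fun x => map_add _ f g)
      map_smul' := fun c f => by
        rw [RingHom.id_apply, ← MemLp.toLp_const_smul]
        exact MemLp.toLp_congr _ _ (ae_of_all _ fun x => map_smul _ c f) }
    (measureUnivNNReal (volume.restrict (Ioo 0 a)) ^ (ENNReal.toReal 2)⁻¹ *
      ((volume.restrict (Ioo 0 a)).real univ ^ (1 / 2 : ℝ)))
    fun f => by
      rw [mul_assoc]
      refine Lp.norm_le_of_ae_bound (by positivity) ?_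
      filter_upwards [(memLp_integralTo f).coeFn_toLp] with x hx
      exact hx ▸ abs_integralTo_le f x

theorem coeFn_primitive (f : L2 a) :
    (primitive a f : ℝ → ℝ) =ᵐ[volume.restrict (Ioo (0 : ℝ) a)] fun x => integralTo a x f :=
  (memLp_integralTo f).coeFn_toLp

theorem memLp_id_mul (f : L2 a) : MemLp (fun x => x * f x) 2 (volume.restrict (Ioo 0 a)) := by
  refine (Lp.memLp f).of_le_mul (c := |a|)
    (measurable_id.aestronglyMeasurable.mul (Lp.aestronglyMeasurable f)) ?_
  filter_upwards [ae_restrict_mem measurableSet_Ioo] with x hx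
  rw [norm_mul]
  refine mul_le_mul_of_nonneg_right ?_ (norm_nonneg _)
  rw [Real.norm_eq_abs, abs_of_pos hx.1, abs_of_pos (hx.1.trans hx.2)]
  exact hx.2.le

/-- Multiplication by `x` as a bounded operator of `L²(0,a)`. -/
def mulX (a : ℝ) : L2 a →L[ℝ] L2 a :=
  LinearMap.mkContinuous
    { toFun := fun f => (memLp_id_mul f).toLp _
      map_add' := fun f g => by
        rw [← MemLp.toLp_add]
        refine MemLp.toLp_congr _ _ ?_
        filter_upwards [Lp.coeFn_add f g] with x hx
        rw [hx, Pi.add_apply, mul_add]; rfl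
      map_smul' := fun c f => by
        rw [RingHom.id_apply, ← MemLp.toLp_const_smul]
        refine MemLp.toLp_congr _ _ ?_
        filter_upwards [Lp.coeFn_smul c f] with x hx
        rw [hx, Pi.smul_apply, smul_eq_mul, mul_left_comm]; rfl }
    |a|
    fun f => by
      refine Lp.norm_le_mul_norm_of_ae_le_mul ?_
      filter_upwards [(memLp_id_mul f).coeFn_toLp, ae_restrict_mem measurableSet_Ioo] with x hx hxa
      refine (congrArg norm hx).trans_le ?_
      rw [norm_mul]
      refine mul_le_mul_of_nonneg_right ?_ (norm_nonneg _)
      rw [Real.norm_eq_abs, abs_of_pos hxa.1, abs_of_pos (hxa.1.trans hxa.2)]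
      exact hxa.2.le

theorem coeFn_mulX (f : L2 a) :
    (mulX a f : ℝ → ℝ) =ᵐ[volume.restrict (Ioo (0 : ℝ) a)] fun x => x * f x :=
  (memLp_id_mul f).coeFn_toLp

theorem inner_L2_eq (f g : L2 a) : ⟪f, g⟫ = ∫ x in Ioo 0 a, f x * g x := by
  rw [L2.inner_def]
  refine integral_congr_ae (ae_of_all _ fun x => ?_)
  simp [mul_comm]

theorem mulX_inner_right (f g : L2 a) : ⟪f, mulX a g⟫ = ⟪mulX a f, g⟫ := by
  rw [inner_L2_eq, inner_L2_eq]
  refine integral_congr_ae ?_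
  filter_upwards [coeFn_mulX f, coeFn_mulX g] with x h1 h2
  rw [h1, h2]; ring

theorem intervalIntegral_congr_ae_Ioo {f g : ℝ → ℝ} {x : ℝ} (hx : x ∈ Icc 0 a)
    (h : f =ᵐ[volume.restrict (Ioo (0 : ℝ) a)] g) :
    ∫ s in (0 : ℝ)..x, f s = ∫ s in (0 : ℝ)..x, g s := by
  rw [intervalIntegral.integral_of_le hx.1, intervalIntegral.integral_of_le hx.1,
    integral_Ioc_eq_integral_Ioo, integral_Ioc_eq_integral_Ioo]
  exact integral_congr_ae (ae_restrict_of_ae_restrict_of_subset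
    (Ioo_subset_Ioo_right hx.2) h)

theorem absolutelyContinuous_integralTo (f : L2 a) {x : ℝ} (hx : x ∈ Icc 0 a) :
    AbsolutelyContinuousOnInterval (fun y => ∫ s in (0 : ℝ)..y, f s) 0 x :=
  (intervalIntegrable_L2 f ⟨le_rfl, hx.1.trans hx.2⟩
    hx).absolutelyContinuousOnInterval_intervalIntegral
    left_mem_uIcc

theorem ae_deriv_primitive (f : L2 a) {x : ℝ} (hx : x ∈ Icc 0 a) :
    ∀ᵐ y, y ∈ uIoc 0 x → deriv (fun y => ∫ s in (0 : ℝ)..y, f s) y = f y := by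
  filter_upwards [(intervalIntegrable_L2 f ⟨le_rfl, hx.1.trans hx.2⟩ hx).ae_hasDerivAt_integral]
    with y hy hyx
  exact (hy (uIoc_subset_uIcc hyx) 0 left_mem_uIcc).deriv

/-- Integration by parts for primitives of `L²` functions, on `(0,x)`. -/
theorem integral_by_parts (f g : L2 a) {x : ℝ} (hx : x ∈ Icc 0 a) :
    ∫ s in (0 : ℝ)..x, (f s * integralTo a s g + integralTo a s f * g s) =
      integralTo a x f * integralTo a x g := by
  have h := (absolutelyContinuous_integralTo f hx).integral_deriv_mul_eq_sub
    (absolutelyContinuous_integralTo g hx)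
  rw [integralTo_apply f hx, integralTo_apply g hx]
  simp only [intervalIntegral.integral_same, mul_zero, sub_zero] at h
  rw [← h]
  refine intervalIntegral.integral_congr_ae ?_
  filter_upwards [ae_deriv_primitive f hx, ae_deriv_primitive g hx] with y h1 h2 hy
  have hy' : y ∈ Icc 0 a := by
    rw [uIoc_of_le hx.1] at hy; exact ⟨hy.1.le, hy.2.trans hx.2⟩
  rw [h1 hy, h2 hy, integralTo_apply _ hy', integralTo_apply _ hy']

theorem inner_eq_intervalIntegral (ha : 0 < a) (f g : L2 a) :
    ⟪f, g⟫ = ∫ x in (0 : ℝ)..a, f x * g x := by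
  rw [inner_L2_eq, intervalIntegral.integral_of_le ha.le, integral_Ioc_eq_integral_Ioo]

theorem intervalIntegrable_L2_mul (f g : L2 a) (ha : 0 ≤ a) :
    IntervalIntegrable (fun x => f x * g x) volume 0 a := by
  rw [intervalIntegrable_iff_integrableOn_Ioo_of_le ha]
  exact (Lp.memLp f).integrable_mul (Lp.memLp g)

/-- Integration by parts: `⟨If,g⟩ + ⟨f,Ig⟩ = (∫f)(∫g)` for the primitive operator `I`. -/
theorem inner_primitive_add (ha : 0 < a) (f g : L2 a) :
    ⟪primitive a f, g⟫ + ⟪f, primitive a g⟫ = integralTo a a f * integralTo a a g := by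
  rw [← integral_by_parts f g (right_mem_Icc.2 ha.le), inner_eq_intervalIntegral ha,
    inner_eq_intervalIntegral ha, ← intervalIntegral.integral_add
      (intervalIntegrable_L2_mul _ _ ha.le) (intervalIntegrable_L2_mul _ _ ha.le)]
  refine intervalIntegral_congr_ae_Ioo (right_mem_Icc.2 ha.le) ?_
  filter_upwards [coeFn_primitive f, coeFn_primitive g] with x h1 h2
  rw [h1, h2]; ring

theorem integralTo_one {x : ℝ} (hx : x ∈ Icc 0 a) : integralTo a x (one a) = x := by
  rw [integralTo_apply _ hx, intervalIntegral_congr_ae_Ioo hx coeFn_one]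
  simp

theorem integralTo_mulX {x : ℝ} (hx : x ∈ Icc 0 a) (f : L2 a) :
    integralTo a x (mulX a f) = x * integralTo a x f - integralTo a x (primitive a f) := by
  have h := integral_by_parts (one a) f hx
  rw [integralTo_one hx] at h
  have e : integralTo a x (primitive a f + mulX a f) = x * integralTo a x f := by
    rw [← h, integralTo_apply _ hx]
    refine intervalIntegral_congr_ae_Ioo hx ?_
    filter_upwards [coeFn_primitive f, coeFn_mulX f, coeFn_one (a := a),
      Lp.coeFn_add (primitive a f) (mulX a f), ae_restrict_mem measurableSet_Ioo]
      with y h1 h2 h3 h4 hy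
    rw [h4, Pi.add_apply, h1, h2, h3, one_mul, integralTo_one ⟨hy.1.le, hy.2.le⟩]
  rw [map_add] at e
  linarith

/-- The commutation rule `x ∫₀ˣ f = ∫₀ˣ s f + ∫₀ˣ ∫₀ˢ f`. -/
theorem mulX_primitive (f : L2 a) :
    mulX a (primitive a f) = primitive a (mulX a f) + primitive a (primitive a f) := by
  refine Lp.ext ?_
  filter_upwards [coeFn_mulX (primitive a f), coeFn_primitive f, coeFn_primitive (mulX a f),
    coeFn_primitive (primitive a f),
    Lp.coeFn_add (primitive a (mulX a f)) (primitive a (primitive a f)),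
    ae_restrict_mem measurableSet_Ioo] with y h1 h2 h3 h4 h5 hy
  rw [h1, h2, h5, Pi.add_apply, h3, h4, integralTo_mulX ⟨hy.1.le, hy.2.le⟩]
  ring

theorem integralTo_primitive_one (ha : 0 < a) :
    integralTo a a (primitive a (one a)) = a ^ 2 / 2 := by
  have h := inner_primitive_add ha (one a) (one a)
  rw [real_inner_comm, ← integralTo_eq_inner, integralTo_one (right_mem_Icc.2 ha.le)] at h
  linarith

/-! ### Weak derivatives and traces on `(0,a)` -/

theorem HasWeakDeriv.primitive_add_const (ha : 0 < a) (g : L2 a) (c : ℝ) :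
    HasWeakDeriv a (primitive a g + c • one a) g := by
  intro φ hφ _ hs
  have h0 : φ 0 = 0 := by
    by_contra h; exact (hs (subset_tsupport _ h)).1.false
  have h1 : φ a = 0 := by
    by_contra h; exact (hs (subset_tsupport _ h)).2.false
  have hφ1 : ContDiff ℝ 1 φ := hφ.of_le (by norm_cast)
  have hc : AbsolutelyContinuousOnInterval φ 0 a := hφ1.contDiffOn.absolutelyContinuousOnInterval
  have hr := right_mem_Icc.2 ha.le
  have ib := (absolutelyContinuous_integralTo g hr).integral_mul_deriv_eq_deriv_mul hc
  have hd : ∫ x in (0 : ℝ)..a, deriv φ x = φ a - φ 0 := hc.integral_deriv_eq_sub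
  rw [← integral_Ioc_eq_integral_Ioo, ← integral_Ioc_eq_integral_Ioo,
    ← intervalIntegral.integral_of_le ha.le, ← intervalIntegral.integral_of_le ha.le]
  have e1 : ∫ x in (0 : ℝ)..a, (primitive a g + c • one a : L2 a) x * deriv φ x =
      ∫ x in (0 : ℝ)..a, ((∫ s in (0 : ℝ)..x, g s) * deriv φ x + c * deriv φ x) := by
    refine intervalIntegral_congr_ae_Ioo hr ?_
    filter_upwards [Lp.coeFn_add (primitive a g) (c • one a), Lp.coeFn_smul c (one a),
      coeFn_primitive g, coeFn_one (a := a), ae_restrict_mem measurableSet_Ioo]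
      with x k1 k2 k3 k4 k5
    rw [k1, Pi.add_apply, k2, Pi.smul_apply, k3, k4, integralTo_apply g ⟨k5.1.le, k5.2.le⟩]
    simp [add_mul]
  have hcd : Continuous (deriv φ) := hφ1.continuous_deriv le_rfl
  have e2 : ∫ x in (0 : ℝ)..a, deriv (fun y => ∫ s in (0 : ℝ)..y, g s) x * φ x =
      ∫ x in (0 : ℝ)..a, g x * φ x := by
    refine intervalIntegral.integral_congr_ae ?_
    filter_upwards [ae_deriv_primitive g hr] with x h hx
    rw [h hx]
  rw [e1, intervalIntegral.integral_add, ib, e2, intervalIntegral.integral_const_mul, hd, h0, h1]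
  · simp
  · exact (hcd.intervalIntegrable _ _).continuousOn_mul
      (absolutelyContinuous_integralTo g hr).continuousOn
  · exact (continuous_const.mul hcd).intervalIntegrable _ _

theorem HasWeakDeriv.primitive (ha : 0 < a) (g : L2 a) : HasWeakDeriv a (primitive a g) g := by
  simpa using HasWeakDeriv.primitive_add_const ha g 0

theorem integrable_mul_test (f : L2 a) {φ : ℝ → ℝ} (hφ : Continuous φ) :
    IntegrableOn (fun x => f x * φ x) (Ioo 0 a) := by
  have h1 : IntegrableOn f (Ioo 0 a) := (Lp.memLp f).integrable (by norm_num)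
  have h2 : IntegrableOn f (Icc 0 a) :=
    (integrableOn_Icc_iff_integrableOn_Ioo (by simp) (by simp)).2 h1
  exact (h2.mul_continuousOn hφ.continuousOn isCompact_Icc).mono_set Ioo_subset_Icc_self

/-- An `L²` function that annihilates all test functions vanishes. -/
theorem eq_zero_of_forall_test (f : L2 a)
    (h : ∀ φ : ℝ → ℝ, ContDiff ℝ ∞ φ → HasCompactSupport φ → tsupport φ ⊆ Ioo 0 a →
      ∫ x in Ioo 0 a, f x * φ x = 0) : f = 0 := by
  have h1 : IntegrableOn f (Ioo 0 a) := (Lp.memLp f).integrable (by norm_num)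
  have h2 := isOpen_Ioo.ae_eq_zero_of_integral_contDiff_smul_eq_zero h1.locallyIntegrableOn
    (fun φ hφ hc hs => by
      refine Eq.trans ?_ (h φ hφ hc hs)
      rw [← integral_indicator measurableSet_Ioo]
      refine integral_congr_ae (ae_of_all _ fun x => ?_)
      by_cases hx : x ∈ Ioo 0 a
      · simp [hx, mul_comm]
      · have : φ x = 0 := by
          by_contra h; exact hx (hs (subset_tsupport _ h))
        simp only [indicator_of_notMem hx, this, zero_smul])
  refine Lp.ext ?_
  rw [Filter.EventuallyEq, ae_restrict_iff' measurableSet_Ioo]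
  filter_upwards [h2, (ae_restrict_iff' measurableSet_Ioo).1
    (Lp.coeFn_zero ℝ 2 (volume.restrict (Ioo (0 : ℝ) a)))] with x hx h0 hxa
  rw [hx hxa, h0 hxa]; rfl

theorem integral_sub_mul_test (f g : L2 a) {φ : ℝ → ℝ} (hφ : Continuous φ) :
    ∫ x in Ioo 0 a, (f - g : L2 a) x * φ x =
      (∫ x in Ioo 0 a, f x * φ x) - ∫ x in Ioo 0 a, g x * φ x := by
  rw [← integral_sub (integrable_mul_test f hφ) (integrable_mul_test g hφ)]
  refine integral_congr_ae ?_
  filter_upwards [Lp.coeFn_sub f g] with x hx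
  rw [hx, Pi.sub_apply, sub_mul]

theorem HasWeakDeriv.sub {f g f' g' : L2 a} (h : HasWeakDeriv a f g) (h' : HasWeakDeriv a f' g') :
    HasWeakDeriv a (f - f') (g - g') := by
  intro φ hφ hc hs
  have hd : Continuous (deriv φ) := (hφ.of_le (by norm_cast) :
    ContDiff ℝ 1 φ).continuous_deriv le_rfl
  rw [integral_sub_mul_test _ _ hd, integral_sub_mul_test _ _ hφ.continuous, h φ hφ hc hs,
    h' φ hφ hc hs]
  ring

theorem HasWeakDeriv.unique {f g g' : L2 a} (h : HasWeakDeriv a f g) (h' : HasWeakDeriv a f g') :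
    g = g' := by
  refine sub_eq_zero.1 (eq_zero_of_forall_test _ fun φ hφ hc hs => ?_)
  have h1 := h φ hφ hc hs
  have h2 := h' φ hφ hc hs
  rw [integral_sub_mul_test _ _ hφ.continuous]
  linarith

/-- A smooth compactly supported function on `(0,a)` of zero mean is the derivative of such a
function. -/
theorem exists_test_primitive {ψ : ℝ → ℝ} (hψ : ContDiff ℝ ∞ ψ) (hc : HasCompactSupport ψ)
    (hs : tsupport ψ ⊆ Ioo 0 a) (h0 : ∫ x in Ioo 0 a, ψ x = 0) :
    ∃ φ : ℝ → ℝ, ContDiff ℝ ∞ φ ∧ HasCompactSupport φ ∧ tsupport φ ⊆ Ioo 0 a ∧ deriv φ = ψ := by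
  have hd : ∀ x, HasDerivAt (fun x => ∫ s in (0 : ℝ)..x, ψ s) (ψ x) x := fun x =>
    (intervalIntegral.integral_hasDerivAt_right (hψ.continuous.intervalIntegrable _ _)
      (hψ.continuous.stronglyMeasurableAtFilter _ _) hψ.continuous.continuousAt)
  have hde : deriv (fun x => ∫ s in (0 : ℝ)..x, ψ s) = ψ := funext fun x => (hd x).deriv
  have hz : ∀ x, x ∉ Ioo 0 a → ψ x = 0 := fun x hx => by
    by_contra h; exact hx (hs (subset_tsupport _ h))
  rcases (tsupport ψ).eq_empty_or_nonempty with he | hne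
  · refine ⟨0, contDiff_const, HasCompactSupport.zero, by simp, ?_⟩
    rw [tsupport_eq_empty_iff] at he
    simp [he]
  have hcomp : IsCompact (tsupport ψ) := hc
  set l := sInf (tsupport ψ)
  set r := sSup (tsupport ψ)
  have hl : l ∈ Ioo 0 a := hs (hcomp.sInf_mem hne)
  have hr : r ∈ Ioo 0 a := hs (hcomp.sSup_mem hne)
  have hsub : ∀ x, x ∉ Icc l r → ψ x = 0 := fun x hx => by
    by_contra h
    exact hx ⟨csInf_le hcomp.bddBelow (subset_tsupport _ h),
      le_csSup hcomp.bddAbove (subset_tsupport _ h)⟩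
  have hsupp : Function.support (fun x => ∫ s in (0 : ℝ)..x, ψ s) ⊆ Icc l r := by
    intro x hx
    by_contra hxn
    apply hx
    rcases lt_or_ge x l with h | h
    · refine intervalIntegral.integral_zero_ae (ae_of_all _ fun s hsx => hsub s fun hh => ?_)
      rw [uIoc, mem_Ioc] at hsx
      have := max_lt hl.1 h
      linarith [hsx.2, hh.1]
    · have hxr : r < x := by
        by_contra hh; exact hxn ⟨h, not_lt.1 hh⟩
      have e1 : ∫ s in x..a, ψ s = 0 :=
        intervalIntegral.integral_zero_ae (ae_of_all _ fun s hsx => hsub s fun hh => by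
          rw [uIoc, mem_Ioc] at hsx
          have := lt_min hxr hr.2
          linarith [hsx.1, hh.2])
      have e2 : ∫ s in (0 : ℝ)..a, ψ s = 0 := by
        rw [intervalIntegral.integral_of_le (hl.1.trans hl.2).le, integral_Ioc_eq_integral_Ioo, h0]
      have e3 := intervalIntegral.integral_add_adjacent_intervals
        (hψ.continuous.intervalIntegrable (μ := volume) 0 x) (hψ.continuous.intervalIntegrable x a)
      simp only
      linarith
  have hts : tsupport (fun x => ∫ s in (0 : ℝ)..x, ψ s) ⊆ Icc l r :=
    closure_minimal hsupp isClosed_Icc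
  refine ⟨_, ?_, HasCompactSupport.of_support_subset_isCompact isCompact_Icc hsupp,
    hts.trans (Icc_subset_Ioo hl.1 hr.2), hde⟩
  rw [contDiff_infty_iff_deriv, hde]
  exact ⟨fun x => (hd x).differentiableAt, hψ⟩

/-- A test function on `(0,a)` of integral `1`. -/
theorem exists_test_integral_eq_one (ha : 0 < a) : ∃ η : ℝ → ℝ, ContDiff ℝ ∞ η ∧
    HasCompactSupport η ∧ tsupport η ⊆ Ioo 0 a ∧ ∫ x in Ioo 0 a, η x = 1 := by
  let b : ContDiffBump (a / 2 : ℝ) := ⟨a / 8, a / 4, by positivity, by linarith⟩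
  have hs : tsupport (b.normed volume) ⊆ Ioo 0 a := by
    rw [b.tsupport_normed_eq, Real.closedBall_eq_Icc]
    exact Icc_subset_Ioo (by change 0 < a / 2 - a / 4; linarith)
      (by change a / 2 + a / 4 < a; linarith)
  refine ⟨b.normed volume, b.contDiff_normed, b.hasCompactSupport_normed, hs, ?_⟩
  rw [← b.integral_normed (μ := volume), ← integral_indicator measurableSet_Ioo]
  refine integral_congr_ae (ae_of_all _ fun x => ?_)
  by_cases hx : x ∈ Ioo 0 a
  · simp [hx]
  · simp only [indicator_of_notMem hx]
    by_contra h
    exact hx (hs (subset_tsupport _ (Ne.symm h)))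

/-- The lemma of du Bois-Reymond: a function with vanishing weak derivative is constant. -/
theorem HasWeakDeriv.eq_const (ha : 0 < a) {f : L2 a} (h : HasWeakDeriv a f 0) :
    ∃ c : ℝ, f = c • one a := by
  obtain ⟨η, hη, hηc, hηs, hη1⟩ := exists_test_integral_eq_one ha
  refine ⟨∫ x in Ioo 0 a, f x * η x, ?_⟩
  set c := ∫ x in Ioo 0 a, f x * η x
  refine sub_eq_zero.1 (eq_zero_of_forall_test _ fun ψ hψ hψc hψs => ?_)
  set m := ∫ x in Ioo 0 a, ψ x
  have hi : ∀ {ρ : ℝ → ℝ}, Continuous ρ → IntegrableOn ρ (Ioo 0 a) := fun hρ =>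
    (hρ.continuousOn.integrableOn_compact isCompact_Icc).mono_set Ioo_subset_Icc_self
  have hts : tsupport (fun x => ψ x - m * η x) ⊆ Ioo 0 a := by
    refine (tsupport_sub _ _).trans (union_subset hψs ?_)
    exact (tsupport_mul_subset_right).trans hηs
  have hmean : ∫ x in Ioo 0 a, (ψ x - m * η x) = 0 := by
    rw [integral_sub (hi hψ.continuous) ((hi hη.continuous).const_mul m), integral_const_mul, hη1]
    simp [m]
  obtain ⟨φ, hφ, hφc, hφs, hφd⟩ := exists_test_primitive
    (hψ.sub (contDiff_const.mul hη)) (hψc.sub (hηc.mul_left)) hts hmean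
  have h1 := h φ hφ hφc hφs
  have h2 : ∫ x in Ioo 0 a, (0 : L2 a) x * φ x = 0 := by
    refine integral_eq_zero_of_ae ?_
    filter_upwards [Lp.coeFn_zero ℝ 2 (volume.restrict (Ioo (0 : ℝ) a))] with x hx
    rw [hx]; simp
  have h3 : ∫ x in Ioo 0 a, f x * deriv φ x = (∫ x in Ioo 0 a, f x * ψ x) - m * c := by
    rw [hφd, ← integral_const_mul, ← integral_sub (integrable_mul_test f hψ.continuous)
      ((integrable_mul_test f hη.continuous).const_mul m)]
    refine integral_congr_ae (ae_of_all _ fun x => ?_)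
    simp only; ring
  have h4 : ∫ x in Ioo 0 a, (c • one a : L2 a) x * ψ x = c * m := by
    rw [← integral_const_mul]
    refine integral_congr_ae ?_
    filter_upwards [Lp.coeFn_smul c (one a), coeFn_one (a := a)] with x k1 k2
    rw [k1, Pi.smul_apply, k2]; simp
  rw [integral_sub_mul_test _ _ hψ.continuous, h4]
  rw [h3, h2] at h1
  linarith

theorem HasWeakDeriv.exists_eq (ha : 0 < a) {f g : L2 a} (h : HasWeakDeriv a f g) :
    ∃ c : ℝ, f = HirotaSatsuma.primitive a g + c • one a := by
  have h1 := h.sub (HasWeakDeriv.primitive ha g)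
  rw [sub_self] at h1
  obtain ⟨c, hc⟩ := h1.eq_const ha
  exact ⟨c, by rw [← hc]; abel⟩

theorem HasTrace.primitive_add_const (g : L2 a) (c : ℝ) (x : ℝ) :
    HasTrace a (primitive a g + c • one a) x (integralTo a x g + c) := by
  refine ⟨fun x => integralTo a x g + c,
    (continuousOn_integralTo g).add continuousOn_const, ?_, rfl⟩
  filter_upwards [Lp.coeFn_add (primitive a g) (c • one a), Lp.coeFn_smul c (one a),
    coeFn_primitive g, coeFn_one (a := a)] with x k1 k2 k3 k4
  rw [k1, Pi.add_apply, k2, Pi.smul_apply, k3, k4]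
  simp

theorem HasTrace.unique (ha : 0 < a) {f : L2 a} {x c c' : ℝ} (hx : x ∈ Icc 0 a)
    (h : HasTrace a f x c) (h' : HasTrace a f x c') : c = c' := by
  obtain ⟨F, hF, hfF, rfl⟩ := h
  obtain ⟨G, hG, hfG, rfl⟩ := h'
  have h1 : EqOn F G (Ioo 0 a) :=
    Measure.eqOn_open_of_ae_eq (hfF.symm.trans hfG) isOpen_Ioo (hF.mono Ioo_subset_Icc_self)
      (hG.mono Ioo_subset_Icc_self)
  have h2 : EqOn F G (Icc 0 a) :=
    h1.of_subset_closure hF hG Ioo_subset_Icc_self (by rw [closure_Ioo ha.ne])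
  exact h2 hx

theorem integralTo_zero (f : L2 a) (ha : 0 ≤ a) : integralTo a 0 f = 0 := by
  rw [integralTo_apply f (left_mem_Icc.2 ha)]; simp

end

/-! ### Third-order identities -/

section

variable {a : ℝ}

/-- `2 ∫ w w''' = w'(0)² - w'(a)²` if `w(0) = w(a) = 0`. Here `w = I w₁`, so that
`∫ w₁ = 0` means `w(a) = 0`, and `d`, `∫ w₂ + d` are the values of `w₁` at `0` and `a`. -/
theorem two_inner_third_deriv (ha : 0 < a) {w₁ w₂ w₃ : L2 a} {c d : ℝ}
    (h₂ : w₂ = primitive a w₃ + c • one a) (h₁ : w₁ = primitive a w₂ + d • one a)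
    (h₀ : integralTo a a w₁ = 0) :
    2 * ⟪primitive a w₁, w₃⟫ = d ^ 2 - (integralTo a a w₂ + d) ^ 2 := by
  have e1 := inner_primitive_add ha w₁ w₃
  have e2 := inner_primitive_add ha w₂ w₂
  have e3 : primitive a w₃ = w₂ - c • one a := by rw [h₂]; abel
  rw [h₀, zero_mul, e3, inner_sub_right, inner_smul_right, real_inner_comm (one a) w₁,
    ← integralTo_eq_inner, h₀, mul_zero, sub_zero] at e1
  have e4 : ⟪w₁, w₂⟫ = ⟪primitive a w₂, w₂⟫ + d * integralTo a a w₂ := by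
    nth_rw 1 [h₁]
    rw [inner_add_left, real_inner_smul_left, integralTo_eq_inner]
  rw [real_inner_comm w₂ (primitive a w₂)] at e2
  rw [real_inner_comm] at e4
  nlinarith [real_inner_comm w₁ w₂, real_inner_comm (primitive a w₂) w₂]

/-- `2 ∫ x w w''' = 3 ∫ (w')² - a w'(a)²` if `w(0) = w(a) = 0`, in the notation of
`two_inner_third_deriv`. -/
theorem two_inner_mulX_third_deriv (ha : 0 < a) {w₁ w₂ w₃ : L2 a} {c d : ℝ}
    (h₂ : w₂ = primitive a w₃ + c • one a) (h₁ : w₁ = primitive a w₂ + d • one a)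
    (h₀ : integralTo a a w₁ = 0) :
    2 * ⟪mulX a (primitive a w₁), w₃⟫ = 3 * ‖w₁‖ ^ 2 - a * (integralTo a a w₂ + d) ^ 2 := by
  have hr := right_mem_Icc.2 ha.le
  have hM := fun f : L2 a => integralTo_mulX hr f
  have e3 : primitive a w₃ = w₂ - c • one a := by rw [h₂]; abel
  have e5 : primitive a w₂ = w₁ - d • one a := by rw [h₁]; abel
  -- `x w` is the primitive of `x w₁ + w`, whose integral vanishes
  have e1 := inner_primitive_add ha (mulX a w₁ + primitive a w₁) w₃
  have z1 : integralTo a a (mulX a w₁ + primitive a w₁) = 0 := by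
    rw [map_add, hM, h₀]; ring
  rw [map_add (primitive a), ← mulX_primitive, z1, e3, inner_sub_right, inner_smul_right,
    real_inner_comm (one a), ← integralTo_eq_inner, z1, inner_add_left] at e1
  have e6 := inner_primitive_add ha w₁ w₂
  rw [h₀, e5, inner_sub_right, inner_smul_right, real_inner_comm (one a), ← integralTo_eq_inner, h₀,
    real_inner_self_eq_norm_sq] at e6
  have e7 := inner_primitive_add ha (mulX a w₂ + primitive a w₂) w₂
  rw [map_add (primitive a), ← mulX_primitive, map_add, hM, e5, map_sub (mulX a),
    map_smul (mulX a)] at e7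
  simp only [inner_sub_left, inner_sub_right, inner_add_left, real_inner_smul_left,
    inner_smul_right, real_inner_self_eq_norm_sq, map_sub, map_smul, smul_eq_mul,
    integralTo_one hr, h₀] at e7
  have s1 : ⟪mulX a w₂, w₁⟫ = ⟪mulX a w₁, w₂⟫ := by rw [← mulX_inner_right, real_inner_comm]
  have s2 : ⟪mulX a (one a), w₂⟫ = integralTo a a (mulX a w₂) := by
    rw [← mulX_inner_right, integralTo_eq_inner]
  have s4 : ⟪mulX a w₂, one a⟫ = integralTo a a (mulX a w₂) := by
    rw [real_inner_comm, integralTo_eq_inner]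
  have s5 : ⟪one a, w₁⟫ = 0 := h₀
  have s6 : ⟪w₁, one a⟫ = 0 := by rw [real_inner_comm, s5]
  have s3 : ‖one a‖ ^ 2 = a := by
    rw [← real_inner_self_eq_norm_sq, ← integralTo_eq_inner, integralTo_one hr]
  have e8 : integralTo a a (mulX a w₂) =
      a * integralTo a a w₂ - integralTo a a (w₁ - d • one a) := by
    rw [hM, e5]
  rw [map_sub, map_smul, h₀, integralTo_one hr, smul_eq_mul] at e8
  rw [s1, s2, s3, s4, s5, s6, e8] at e7
  linarith

end

/-! ### The inverse of the operator `A` -/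

section

variable (L h α β : ℝ)

/-- The first component of an element of `H`. -/
def projU : H L →L[ℝ] L2 L := (WithLp.fstL 2 ℝ (L2 L) (L2 L)).comp (ContinuousLinearMap.fst ℝ _ _)

/-- The second component of an element of `H`. -/
def projV : H L →L[ℝ] L2 L := (WithLp.sndL 2 ℝ (L2 L) (L2 L)).comp (ContinuousLinearMap.fst ℝ _ _)

/-- The third component of an element of `H`. -/
def projZ : H L →L[ℝ] L2 1 := ContinuousLinearMap.snd ℝ _ _

/-- The second derivative of the solution `u` of `½ u_xxx = f`, `u(0) = u(L) = u_x(0) = 0`, as a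
function of `F = (f,g,k)`. It is a primitive of `2f`, and the constant of integration makes
`u(L) = 0`, as `∫₀ᴸ x dx = L²/2`. -/
def solUxx : H L →L[ℝ] L2 L :=
  (2 : ℝ) • (primitive L).comp (projU L) -
    ((4 / L ^ 2) • (integralTo L L).comp ((primitive L).comp ((primitive L).comp
      (projU L)))).smulRight (one L)

/-- The derivative of the solution `u` of `½ u_xxx = f`, `u(0) = u(L) = u_x(0) = 0`. -/
def solUx : H L →L[ℝ] L2 L := (primitive L).comp (solUxx L)

/-- The boundary value `u_x(L)` of the solution of `A (u,v,z) = F`. -/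
def traceUx : H L →L[ℝ] ℝ := (integralTo L L).comp (solUxx L)

/-- The boundary value `z(1)` of the solution of `A (u,v,z) = F`. -/
def traceZ : H L →L[ℝ] ℝ := traceUx L - h • (integralTo 1 1).comp (projZ L)

/-- The boundary value `v_x(L) = α u_x(L) + β z(1)` of the solution of `A (u,v,z) = F`. -/
def traceVx : H L →L[ℝ] ℝ := α • traceUx L + β • traceZ L h

/-- The boundary value `v_xx(0)` of the solution of `A (u,v,z) = F`. Together with `v_x(0)` it is
determined by the two conditions at `x = L`. -/
def traceVxx : H L →L[ℝ] ℝ :=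
  (2 / L ^ 2) • (L • traceVx L h α β + L • (integralTo L L).comp ((primitive L).comp (projV L)) -
    (integralTo L L).comp ((primitive L).comp ((primitive L).comp (projV L))))

/-- The boundary value `v_x(0)` of the solution of `A (u,v,z) = F`. -/
def traceVx₀ : H L →L[ℝ] ℝ :=
  traceVx L h α β + (integralTo L L).comp ((primitive L).comp (projV L)) - L • traceVxx L h α β

/-- The second derivative of the component `v` of the solution of `A (u,v,z) = F`. -/
def solVxx : H L →L[ℝ] L2 L :=
  (traceVxx L h α β).smulRight (one L) - (primitive L).comp (projV L)

/-- The derivative of the component `v` of the solution of `A (u,v,z) = F`. -/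
def solVx : H L →L[ℝ] L2 L :=
  (primitive L).comp (solVxx L h α β) + (traceVx₀ L h α β).smulRight (one L)

/-- The component `z` of the solution of `A (u,v,z) = F`. -/
def solZ : H L →L[ℝ] L2 1 :=
  (traceUx L).smulRight (one 1) - h • (primitive 1).comp (projZ L)

/-- The pair `(u_x,v_x)` of derivatives of the solution of `A (u,v,z) = F`. -/
def solDx : H L →L[ℝ] X0 L :=
  ((WithLp.prodContinuousLinearEquiv 2 ℝ (L2 L) (L2 L)).symm : (L2 L × L2 L) →L[ℝ] X0 L).comp
    ((solUx L).prod (solVx L h α β))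

/-- The inverse of the operator `A`, which is bounded on `H`. -/
def invA : H L →L[ℝ] H L :=
  (((WithLp.prodContinuousLinearEquiv 2 ℝ (L2 L) (L2 L)).symm : (L2 L × L2 L) →L[ℝ] X0 L).comp
    (((primitive L).comp (solUx L)).prod ((primitive L).comp (solVx L h α β)))).prod (solZ L h)

end

section

variable {L h α β : ℝ}

theorem invA_fst_fst (F : H L) : (invA L h α β F).1.fst = primitive L (solUx L F) := rfl

theorem invA_fst_snd (F : H L) : (invA L h α β F).1.snd = primitive L (solVx L h α β F) := rfl

theorem invA_snd (F : H L) : (invA L h α β F).2 = solZ L h F := rfl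

theorem solDx_fst (F : H L) : (solDx L h α β F).fst = solUx L F := rfl

theorem solDx_snd (F : H L) : (solDx L h α β F).snd = solVx L h α β F := rfl

theorem traceUx_apply (F : H L) : traceUx L F = integralTo L L (solUxx L F) := rfl

theorem traceZ_apply (F : H L) : traceZ L h F = traceUx L F - h * integralTo 1 1 F.2 := rfl

theorem traceVx_apply (F : H L) :
    traceVx L h α β F = α * traceUx L F + β * traceZ L h F := rfl

theorem solUxx_eq (F : H L) : solUxx L F = primitive L ((2 : ℝ) • F.1.fst) +
    (-(4 / L ^ 2 * integralTo L L (primitive L (primitive L F.1.fst)))) • one L := by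
  rw [map_smul, neg_smul, ← sub_eq_add_neg]; rfl

theorem solUx_eq (F : H L) : solUx L F = primitive L (solUxx L F) + (0 : ℝ) • one L := by
  rw [zero_smul, add_zero]; rfl

theorem integralTo_solUx (hL : 0 < L) (F : H L) : integralTo L L (solUx L F) = 0 := by
  rw [solUx_eq, solUxx_eq]
  simp only [map_add, map_smul, smul_eq_mul, integralTo_primitive_one hL, zero_mul, add_zero]
  field_simp
  ring

theorem solVxx_eq (F : H L) : solVxx L h α β F = primitive L (-F.1.snd) +
    (traceVxx L h α β F) • one L := by
  rw [map_neg, neg_add_eq_sub]; rfl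

theorem solVx_eq (F : H L) : solVx L h α β F = primitive L (solVxx L h α β F) +
    (traceVx₀ L h α β F) • one L := rfl

theorem traceVxx_apply (F : H L) : traceVxx L h α β F =
    2 / L ^ 2 * (L * traceVx L h α β F + L * integralTo L L (primitive L F.1.snd) -
      integralTo L L (primitive L (primitive L F.1.snd))) := rfl

theorem traceVx₀_apply (F : H L) : traceVx₀ L h α β F =
    traceVx L h α β F + integralTo L L (primitive L F.1.snd) - L * traceVxx L h α β F := rfl

theorem integralTo_solVxx (hL : 0 < L) (F : H L) :
    integralTo L L (solVxx L h α β F) + traceVx₀ L h α β F = traceVx L h α β F := by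
  rw [solVxx_eq, traceVx₀_apply, map_add, map_smul,
    integralTo_one (right_mem_Icc.2 hL.le), map_neg, map_neg, smul_eq_mul]
  ring

theorem integralTo_solVx (hL : 0 < L) (F : H L) : integralTo L L (solVx L h α β F) = 0 := by
  rw [solVx_eq, solVxx_eq, traceVx₀_apply, traceVxx_apply]
  simp only [map_add, map_smul, map_neg, smul_eq_mul, integralTo_primitive_one hL,
    integralTo_one (right_mem_Icc.2 hL.le)]
  field_simp
  ring

theorem solZ_eq (F : H L) : solZ L h F = primitive 1 (-(h • F.2)) + (traceUx L F) • one 1 := by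
  rw [map_neg, map_smul, neg_add_eq_sub]; rfl

theorem integralTo_solZ (F : H L) : integralTo 1 1 (-(h • F.2)) + traceUx L F = traceZ L h F := by
  rw [traceZ_apply, map_neg, map_smul, smul_eq_mul]; ring

/-! ### Identities for the multipliers `1` and `x` -/

theorem two_inner_invA_u (hL : 0 < L) (F : H L) :
    2 * ⟪(invA L h α β F).1.fst, F.1.fst⟫ = -(1 / 2) * traceUx L F ^ 2 := by
  have e := two_inner_third_deriv hL (solUxx_eq F) (solUx_eq F) (integralTo_solUx hL F)
  rw [inner_smul_right, ← traceUx_apply] at e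
  rw [invA_fst_fst]
  linarith

theorem two_inner_mulX_invA_u (hL : 0 < L) (F : H L) :
    2 * ⟪mulX L (invA L h α β F).1.fst, F.1.fst⟫ =
      3 / 2 * ‖solUx L F‖ ^ 2 - L / 2 * traceUx L F ^ 2 := by
  have e := two_inner_mulX_third_deriv hL (solUxx_eq F) (solUx_eq F) (integralTo_solUx hL F)
  rw [inner_smul_right, ← traceUx_apply] at e
  rw [invA_fst_fst]
  linarith

theorem two_inner_invA_v (hL : 0 < L) (F : H L) :
    2 * ⟪(invA L h α β F).1.snd, F.1.snd⟫ =
      traceVx L h α β F ^ 2 - traceVx₀ L h α β F ^ 2 := by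
  have e := two_inner_third_deriv hL (solVxx_eq F) (solVx_eq (h := h) (α := α) (β := β) F)
    (integralTo_solVx hL F)
  rw [integralTo_solVxx hL, inner_neg_right] at e
  rw [invA_fst_snd]
  linarith

theorem two_inner_mulX_invA_v (hL : 0 < L) (F : H L) :
    2 * ⟪mulX L (invA L h α β F).1.snd, F.1.snd⟫ =
      L * traceVx L h α β F ^ 2 - 3 * ‖solVx L h α β F‖ ^ 2 := by
  have e := two_inner_mulX_third_deriv hL (solVxx_eq F) (solVx_eq (h := h) (α := α) (β := β) F)
    (integralTo_solVx hL F)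
  rw [integralTo_solVxx hL, inner_neg_right] at e
  rw [invA_fst_snd]
  linarith

theorem two_inner_invA_z (F : H L) :
    2 * h * ⟪(invA L h α β F).2, F.2⟫ = traceUx L F ^ 2 - traceZ L h F ^ 2 := by
  have e := inner_primitive_add one_pos F.2 F.2
  rw [real_inner_comm (primitive 1 F.2)] at e
  rw [invA_snd, solZ_eq, traceZ_apply, map_neg, map_smul, inner_add_left, inner_neg_left,
    real_inner_smul_left, real_inner_smul_left, ← integralTo_eq_inner]
  linear_combination -h ^ 2 * e

/-- `A` is dissipative for the weighted inner product of `H`. -/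
theorem inner_invA_nonpos (hL : 0 < L) (hβ : 0 < β) (hgain : 2 * α ^ 2 + 3 / 2 * β < 1 / 2)
    (F : H L) :
    ⟪(invA L h α β F).1.fst, F.1.fst⟫ + ⟪(invA L h α β F).1.snd, F.1.snd⟫ +
      β * h * ⟪(invA L h α β F).2, F.2⟫ ≤ 0 := by
  have e1 := two_inner_invA_u (h := h) (α := α) (β := β) hL F
  have e2 := two_inner_invA_v (h := h) (α := α) (β := β) hL F
  have e3 := two_inner_invA_z (h := h) (α := α) (β := β) F
  rw [traceVx_apply] at e2
  set p := traceUx L F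
  set q := traceZ L h F
  have h1 : 0 ≤ (1 / 2 - 2 * α ^ 2 - β) * p ^ 2 := mul_nonneg (by linarith) (sq_nonneg p)
  have hβ' : β < 1 / 2 := by nlinarith [sq_nonneg α]
  have h2 : 0 ≤ β * (1 - 2 * β) * q ^ 2 :=
    mul_nonneg (mul_nonneg hβ.le (by linarith)) (sq_nonneg q)
  nlinarith [sq_nonneg (α * p - β * q), sq_nonneg (traceVx₀ L h α β F)]

/-! ### The graph of `A` -/

theorem eq_const_of_hasTrace_zero {a : ℝ} (ha : 0 < a) {g : L2 a} {c t : ℝ}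
    (h : HasTrace a (primitive a g + c • one a) 0 t) : c = t := by
  have := (HasTrace.primitive_add_const g c 0).unique ha (left_mem_Icc.2 ha.le) h
  rwa [integralTo_zero g ha.le, zero_add] at this

theorem integralTo_add_eq_of_hasTrace {a : ℝ} (ha : 0 < a) {g : L2 a} {c t : ℝ}
    (h : HasTrace a (primitive a g + c • one a) a t) : integralTo a a g + c = t :=
  (HasTrace.primitive_add_const g c a).unique ha (right_mem_Icc.2 ha.le) h

theorem hasTrace_zero {a : ℝ} (ha : 0 < a) (g : L2 a) (c : ℝ) :
    HasTrace a (primitive a g + c • one a) 0 c := by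
  have := HasTrace.primitive_add_const g c 0
  rwa [integralTo_zero g ha.le, zero_add] at this

theorem hasWeakDeriv_invA_u (hL : 0 < L) (F : H L) :
    HasWeakDeriv L (invA L h α β F).1.fst (solUx L F) :=
  HasWeakDeriv.primitive hL _

theorem hasWeakDeriv_invA_v (hL : 0 < L) (F : H L) :
    HasWeakDeriv L (invA L h α β F).1.snd (solVx L h α β F) :=
  HasWeakDeriv.primitive hL _

theorem hasTrace_solUx (F : H L) : HasTrace L (solUx L F) L (traceUx L F) := by
  rw [solUx_eq, traceUx_apply]
  simpa using HasTrace.primitive_add_const (solUxx L F) 0 L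

theorem hasTrace_solZ (F : H L) : HasTrace 1 (invA L h α β F).2 1 (traceZ L h F) := by
  rw [invA_snd, solZ_eq, ← integralTo_solZ]
  exact HasTrace.primitive_add_const _ _ 1

theorem isA_invA (hL : 0 < L) (hh : 0 < h) (F : H L) : IsA h α β (invA L h α β F) F := by
  refine ⟨solUx L F, solUxx L F, (2 : ℝ) • F.1.fst, solVx L h α β F, solVxx L h α β F, -F.1.snd,
    -(h • F.2), traceUx L F, traceZ L h F, ⟨hasWeakDeriv_invA_u hL F, ?_, ?_⟩,
    ⟨hasWeakDeriv_invA_v hL F, ?_, ?_⟩, ?_, ⟨?_, ?_⟩, ⟨?_, ?_⟩, ?_, ⟨hasTrace_solUx F, ?_⟩,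
    ⟨hasTrace_solZ F, ?_⟩, ?_⟩
  · rw [solUx_eq]; exact HasWeakDeriv.primitive_add_const hL _ _
  · rw [solUxx_eq]; exact HasWeakDeriv.primitive_add_const hL _ _
  · rw [solVx_eq]; exact HasWeakDeriv.primitive_add_const hL _ _
  · rw [solVxx_eq]; exact HasWeakDeriv.primitive_add_const hL _ _
  · rw [invA_snd, solZ_eq]; exact HasWeakDeriv.primitive_add_const one_pos _ _
  · rw [invA_fst_fst]; simpa using hasTrace_zero hL (solUx L F) 0
  · rw [invA_fst_fst]
    simpa [integralTo_solUx hL] using HasTrace.primitive_add_const (solUx L F) 0 L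
  · rw [invA_fst_snd]; simpa using hasTrace_zero hL (solVx L h α β F) 0
  · rw [invA_fst_snd]
    simpa [integralTo_solVx hL] using HasTrace.primitive_add_const (solVx L h α β F) 0 L
  · rw [solUx_eq]; exact hasTrace_zero hL _ _
  · rw [invA_snd, solZ_eq]; exact hasTrace_zero one_pos _ _
  · rw [← traceVx_apply, ← integralTo_solVxx hL, solVx_eq]
    exact HasTrace.primitive_add_const _ _ L
  · rw [smul_smul, smul_neg, smul_smul, neg_neg, neg_neg, one_div_mul_cancel hh.ne']
    norm_num
    rfl

/-- The boundary conditions determine the constants of integration, so that `invA F` is the only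
solution of `A U = F`. -/
theorem eq_invA_of_isA (hL : 0 < L) (hh : 0 < h) {U F : H L} (hUF : IsA h α β U F) :
    U = invA L h α β F := by
  obtain ⟨u₁, u₂, u₃, v₁, v₂, v₃, z₁, p, q, ⟨hu, hu₁, hu₂⟩, ⟨hv, hv₁, hv₂⟩, hz, ⟨tu0, tuL⟩,
    ⟨tv0, tvL⟩, tu1, ⟨tp, tzp⟩, ⟨tzq, tv1⟩, hF⟩ := hUF
  have fu : u₃ = (2 : ℝ) • F.1.fst := by rw [hF]; simp [smul_smul]
  have fv : v₃ = -F.1.snd := by rw [hF]; simp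
  have fz : z₁ = -(h • F.2) := by rw [hF]; simp [smul_smul, hh.ne']
  obtain ⟨c, rfl⟩ := hu₂.exists_eq hL
  obtain ⟨d, rfl⟩ := hu₁.exists_eq hL
  obtain ⟨e, hu'⟩ := hu.exists_eq hL
  obtain ⟨c', rfl⟩ := hv₂.exists_eq hL
  obtain ⟨d', rfl⟩ := hv₁.exists_eq hL
  obtain ⟨e', hv'⟩ := hv.exists_eq hL
  obtain ⟨f, hz'⟩ := hz.exists_eq one_pos
  rw [hu'] at tu0 tuL
  rw [hv'] at tv0 tvL
  rw [hz'] at tzp tzq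
  have hd := eq_const_of_hasTrace_zero hL tu1
  have he := eq_const_of_hasTrace_zero hL tu0
  have he' := eq_const_of_hasTrace_zero hL tv0
  have hf := eq_const_of_hasTrace_zero one_pos tzp
  have iu := integralTo_add_eq_of_hasTrace hL tuL
  have iv := integralTo_add_eq_of_hasTrace hL tvL
  have ip := integralTo_add_eq_of_hasTrace hL tp
  have iq := integralTo_add_eq_of_hasTrace one_pos tzq
  have ir := integralTo_add_eq_of_hasTrace hL tv1
  subst hd he he' hf fu fv fz
  have h1 := integralTo_one (right_mem_Icc.2 hL.le)
  have hc : c = -(4 / L ^ 2 * integralTo L L (primitive L (primitive L F.1.fst))) := by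
    simp only [map_add, map_smul, smul_eq_mul, integralTo_primitive_one hL, zero_mul,
      add_zero] at iu
    field_simp
    linarith
  have hu2 : primitive L ((2 : ℝ) • F.1.fst) + c • one L = solUxx L F := by rw [solUxx_eq, hc]
  rw [hu2, add_zero, ← traceUx_apply] at ip
  subst ip
  rw [integralTo_solZ] at iq
  subst iq
  rw [← traceVx_apply] at ir
  have hd' : d' = traceVx L h α β F + integralTo L L (primitive L F.1.snd) - L * c' := by
    rw [← ir]
    simp only [map_add, map_smul, map_neg, smul_eq_mul, h1]
    ring
  have hc' : c' = traceVxx L h α β F := by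
    rw [traceVxx_apply]
    simp only [map_add, map_smul, map_neg, smul_eq_mul, integralTo_primitive_one hL, h1, hd'] at iv
    field_simp
    linarith
  have hd'' : d' = traceVx₀ L h α β F := by rw [hd', hc', traceVx₀_apply]
  refine Prod.ext (WithLp.ofLp_injective 2 (Prod.ext ?_ ?_)) ?_
  · change U.1.fst = _
    rw [hu', hu2, ← solUx_eq, zero_smul, add_zero]; rfl
  · change U.1.snd = _
    rw [hv', hc', hd'', ← solVxx_eq, ← solVx_eq, zero_smul, add_zero]; rfl
  · rw [hz', invA_snd, solZ_eq]

theorem eq_zero_of_primitive_add_const {a : ℝ} (ha : 0 < a) {g : L2 a} {c : ℝ}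
    (h : primitive a g + c • one a = 0) : g = 0 := by
  have h1 := HasWeakDeriv.primitive_add_const ha g c
  have h2 := HasWeakDeriv.primitive ha (0 : L2 a)
  rw [map_zero] at h2
  rw [h] at h1
  exact h1.unique h2

theorem eq_zero_of_primitive {a : ℝ} (ha : 0 < a) {g : L2 a} (h : primitive a g = 0) : g = 0 :=
  eq_zero_of_primitive_add_const (c := 0) ha (by rw [h]; simp)

theorem eq_zero_of_invA_eq_zero (hL : 0 < L) (hh : 0 < h) {F : H L}
    (hF : invA L h α β F = 0) : F = 0 := by
  have hu : solUx L F = 0 :=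
    eq_zero_of_primitive hL (congrArg (fun U : H L => U.1.fst) hF)
  have hv : solVx L h α β F = 0 :=
    eq_zero_of_primitive hL (congrArg (fun U : H L => U.1.snd) hF)
  have hz : solZ L h F = 0 := congrArg Prod.snd hF
  rw [solUx_eq] at hu
  rw [solVx_eq] at hv
  rw [solZ_eq] at hz
  have hu' := eq_zero_of_primitive_add_const hL hu
  have hv' := eq_zero_of_primitive_add_const hL hv
  have hz' := eq_zero_of_primitive_add_const one_pos hz
  rw [solUxx_eq] at hu'
  rw [solVxx_eq] at hv'
  have h1 := eq_zero_of_primitive_add_const hL hu'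
  have h2 := eq_zero_of_primitive_add_const hL hv'
  refine Prod.ext (WithLp.ofLp_injective 2 (Prod.ext ?_ ?_)) ?_
  · exact (smul_eq_zero.1 h1).resolve_left two_ne_zero
  · exact neg_eq_zero.1 h2
  · exact (smul_eq_zero.1 (neg_eq_zero.1 hz')).resolve_left hh.ne'

end

/-! ### Evolution equations `W = K W'` with a dissipative bounded operator `K` -/

section

variable {E : Type*} [NormedAddCommGroup E] [InnerProductSpace ℝ E]

/-- `⟨N w, w⟩' = 2 ⟨N w, w'⟩` for a symmetric operator `N`, in integrated form. -/
theorem integral_two_inner_eq_sub (N : E →L[ℝ] E) (hN : ∀ x y, ⟪x, N y⟫ = ⟪N x, y⟫) {w v : ℝ → E}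
    (hv : Continuous v) (hw : ∀ t, HasDerivAt w (v t) t) (t : ℝ) :
    ∫ s in (0 : ℝ)..t, 2 * ⟪N (w s), v s⟫ = ⟪N (w t), w t⟫ - ⟪N (w 0), w 0⟫ := by
  have hwc : Continuous w := continuous_iff_continuousAt.2 fun t => (hw t).continuousAt
  have hc : Continuous fun s => 2 * ⟪N (w s), v s⟫ :=
    continuous_const.mul ((N.continuous.comp hwc).inner hv)
  refine intervalIntegral.integral_eq_sub_of_hasDerivAt (f := fun s => ⟪N (w s), w s⟫)
    (fun s _ => ?_) (hc.intervalIntegrable _ _)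
  have h := (N.hasFDerivAt.comp_hasDerivAt s (hw s)).inner ℝ (hw s)
  refine h.congr_deriv ?_
  rw [Function.comp_apply, ← hN, real_inner_comm, two_mul]

theorem hasDerivAt_add_integral {F : Type*} [NormedAddCommGroup F] [NormedSpace ℝ F]
    [CompleteSpace F] {v : ℝ → F} (hv : Continuous v) (w₀ : F) (t : ℝ) :
    HasDerivAt (fun t => w₀ + ∫ s in (0 : ℝ)..t, v s) (v t) t :=
  (intervalIntegral.integral_hasDerivAt_right (hv.intervalIntegrable _ _)
    (hv.stronglyMeasurableAtFilter _ _) hv.continuousAt).const_add w₀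

/-- Solutions of `W = K W'` with a dissipative operator `K` do not grow. -/
theorem norm_le_of_dissipative [CompleteSpace E] {K : E →L[ℝ] E} (hK : ∀ x, ⟪K x, x⟫ ≤ 0)
    {T : ℝ} {v : ℝ → E} (hv : Continuous v) {w₀ : E}
    (h : ∀ t ∈ Icc 0 T, w₀ + ∫ s in (0 : ℝ)..t, v s = K (v t)) {t : ℝ} (ht : t ∈ Icc 0 T) :
    ‖K (v t)‖ ≤ ‖w₀‖ := by
  have e := integral_two_inner_eq_sub (ContinuousLinearMap.id ℝ E) (fun _ _ => rfl) hv
    (hasDerivAt_add_integral hv w₀) t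
  simp only [ContinuousLinearMap.id_apply, intervalIntegral.integral_same, add_zero,
    real_inner_self_eq_norm_sq] at e
  have hi : 0 ≤ ∫ s in (0 : ℝ)..t, -(2 * ⟪w₀ + ∫ r in (0 : ℝ)..s, v r, v s⟫) := by
    refine intervalIntegral.integral_nonneg ht.1 fun s hs => ?_
    rw [h s ⟨hs.1, hs.2.trans ht.2⟩]
    linarith [hK (v s)]
  rw [intervalIntegral.integral_neg, e, h t ht] at hi
  exact (pow_le_pow_iff_left₀ (norm_nonneg _) (norm_nonneg _) two_ne_zero).1 (by linarith)

theorem exists_equiv_of_dissipative [CompleteSpace E] {K : E →L[ℝ] E}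
    (hK : ∀ x, ⟪K x, x⟫ ≤ 0) {ε : ℝ} (hε : 0 < ε) :
    ∃ e : E ≃L[ℝ] E, ∀ x, e x = ε • x - K x := by
  let B : E →L[ℝ] E →L[ℝ] ℝ := (innerSL ℝ).comp (ε • ContinuousLinearMap.id ℝ E - K)
  have hB : IsCoercive B := by
    refine ⟨ε, hε, fun u => ?_⟩
    change ε * ‖u‖ * ‖u‖ ≤ ⟪ε • u - K u, u⟫
    rw [inner_sub_left, real_inner_smul_left, real_inner_self_eq_norm_sq]
    nlinarith [hK u]
  refine ⟨hB.continuousLinearEquivOfBilin, fun x => ext_inner_right ℝ fun y => ?_⟩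
  rw [hB.continuousLinearEquivOfBilin_apply]; rfl

/-- The Yosida regularization: the equation `D = (K - ε) D'`, which is governed by the bounded
dissipative operator `(K - ε)⁻¹`, has a solution with `D'(0) = y`, and `D' = V` does not grow. -/
theorem exists_regularized [CompleteSpace E] {K : E →L[ℝ] E}
    (hK : ∀ x, ⟪K x, x⟫ ≤ 0) {ε : ℝ} (hε : 0 < ε) (y : E) :
    ∃ V : ℝ → E, Continuous V ∧ V 0 = y ∧ (∀ t, 0 ≤ t → ‖V t‖ ≤ ‖y‖) ∧
      ∀ t, HasDerivAt (fun t => K (V t) - ε • V t) (V t) t := by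
  obtain ⟨e, he⟩ := exists_equiv_of_dissipative hK hε
  let G : E →L[ℝ] E := -(e.symm : E →L[ℝ] E)
  have hG : ∀ x, K (G x) - ε • G x = x := fun x => by
    have := he (e.symm x)
    rw [e.apply_symm_apply] at this
    change K (-(e.symm x)) - ε • (-(e.symm x)) = x
    rw [map_neg, smul_neg]
    nth_rw 3 [this]; abel
  have hGd : ∀ x, ⟪x, G x⟫ ≤ 0 := fun x => by
    nth_rw 1 [← hG x]
    rw [inner_sub_left, real_inner_smul_left, real_inner_self_eq_norm_sq]
    nlinarith [hK (G x), sq_nonneg ‖G x‖]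
  let V : ℝ → E := fun t => NormedSpace.exp (t • G) y
  have hV : ∀ t, HasDerivAt V (G (V t)) t := fun t => by
    have h := hasDerivAt_exp_smul_const' G t
    exact (ContinuousLinearMap.apply ℝ E y).hasFDerivAt.comp_hasDerivAt t h
  have hVc : Continuous V := continuous_iff_continuousAt.2 fun t => (hV t).continuousAt
  have hV0 : V 0 = y := by simp [V]
  refine ⟨V, hVc, hV0, fun t ht => ?_, fun t => ?_⟩
  · have hn : Antitone fun t => ‖V t‖ ^ 2 := by
      refine antitone_of_hasDerivAt_nonpos (fun t => (hV t).norm_sq) fun t => ?_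
      change 2 * ⟪V t, G (V t)⟫ ≤ 0
      linarith [hGd (V t)]
    have := hn ht
    simp only [hV0] at this
    exact (pow_le_pow_iff_left₀ (norm_nonneg _) (norm_nonneg _) two_ne_zero).1 this
  · have h := (K.hasFDerivAt.comp_hasDerivAt t (hV t)).sub ((hV t).const_smul ε)
    exact h.congr_deriv (hG _)

/-- Comparison of two regularized solutions. -/
theorem norm_sub_sq_le_of_regularized {K : E →L[ℝ] E} (hK : ∀ x, ⟪K x, x⟫ ≤ 0) {ε δ : ℝ}
    (hε : 0 < ε) (hδ : 0 < δ) {y : E} {V W : ℝ → E} (hV0 : V 0 = y) (hW0 : W 0 = y)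
    (hV : ∀ t, 0 ≤ t → ‖V t‖ ≤ ‖y‖) (hW : ∀ t, 0 ≤ t → ‖W t‖ ≤ ‖y‖)
    (hV' : ∀ t, HasDerivAt (fun t => K (V t) - ε • V t) (V t) t)
    (hW' : ∀ t, HasDerivAt (fun t => K (W t) - δ • W t) (W t) t) {t : ℝ} (ht : 0 ≤ t) :
    ‖(K (V t) - ε • V t) - (K (W t) - δ • W t)‖ ^ 2 ≤
      (ε - δ) ^ 2 * ‖y‖ ^ 2 + 4 * t * (ε + δ) * ‖y‖ ^ 2 := by
  set D : ℝ → E := fun t => (K (V t) - ε • V t) - (K (W t) - δ • W t)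
  have hD : ∀ t, HasDerivAt D (V t - W t) t := fun t => (hV' t).sub (hW' t)
  set N : ℝ → ℝ := fun t => ‖D t‖ ^ 2 - 4 * t * (ε + δ) * ‖y‖ ^ 2
  have hN : ∀ t, HasDerivAt N (2 * ⟪D t, V t - W t⟫ - 4 * (ε + δ) * ‖y‖ ^ 2) t := fun t => by
    refine (hD t).norm_sq.sub ?_
    have := (((hasDerivAt_id t).const_mul 4).mul_const (ε + δ)).mul_const (‖y‖ ^ 2)
    simpa using this
  have hanti : AntitoneOn N (Ici 0) := by
    refine antitoneOn_of_deriv_nonpos (convex_Ici 0)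
      (fun t _ => (hN t).continuousAt.continuousWithinAt)
      (fun t _ => (hN t).differentiableAt.differentiableWithinAt) fun t ht' => ?_
    rw [interior_Ici] at ht'
    rw [(hN t).deriv]
    have a1 : D t = K (V t - W t) + (δ • W t - ε • V t) := by
      simp only [D, map_sub]; abel
    have a2 : ⟪δ • W t - ε • V t, V t - W t⟫ ≤ (δ * ‖y‖ + ε * ‖y‖) * (‖y‖ + ‖y‖) := by
      refine (real_inner_le_norm _ _).trans (mul_le_mul ?_ ?_ (norm_nonneg _) (by positivity))
      · refine (norm_sub_le _ _).trans ?_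
        rw [norm_smul, norm_smul, Real.norm_of_nonneg hε.le, Real.norm_of_nonneg hδ.le]
        exact add_le_add (mul_le_mul_of_nonneg_left (hW t (le_of_lt ht')) hδ.le)
          (mul_le_mul_of_nonneg_left (hV t (le_of_lt ht')) hε.le)
      · exact (norm_sub_le _ _).trans (add_le_add (hV t (le_of_lt ht')) (hW t (le_of_lt ht')))
    rw [a1, inner_add_left]
    nlinarith [hK (V t - W t)]
  have h := hanti (mem_Ici.2 le_rfl) (mem_Ici.2 ht) ht
  have h0 : ‖D 0‖ ^ 2 = (ε - δ) ^ 2 * ‖y‖ ^ 2 := by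
    have : D 0 = (δ - ε) • y := by simp only [D, hV0, hW0, sub_smul]; abel
    rw [this, norm_smul, mul_pow, Real.norm_eq_abs, sq_abs]; ring
  simp only [N, h0] at h
  linarith

theorem continuous_integral_IccExtend {F : Type*} [NormedAddCommGroup F] [NormedSpace ℝ F]
    {T : ℝ} (hT : 0 ≤ T) (t : ℝ) :
    Continuous fun U : C(Icc (0 : ℝ) T, F) => ∫ s in (0 : ℝ)..t, IccExtend hT U s := by
  have hi : ∀ U : C(Icc (0 : ℝ) T, F), IntervalIntegrable (IccExtend hT U) volume 0 t :=
    fun U => (U.continuous.Icc_extend' (h := hT)).intervalIntegrable _ _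
  refine (LipschitzWith.of_dist_le_mul (K := Real.toNNReal |t|) fun U W => ?_).continuous
  rw [dist_eq_norm, ← intervalIntegral.integral_sub (hi U) (hi W), mul_comm,
    Real.coe_toNNReal _ (abs_nonneg t)]
  have := intervalIntegral.norm_integral_le_of_norm_le_const (a := 0) (b := t) (C := dist U W)
    (f := fun s => IccExtend hT U s - IccExtend hT W s) fun s _ => by
      rw [← dist_eq_norm]
      exact ContinuousMap.dist_apply_le_dist _
  simpa using this

/-- For every `y` the equation `W = K W'` has a mild solution `D` with `D(0) = K y`. It is the
limit of the solutions of the regularized equations. -/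
theorem exists_mild_of_dissipative [CompleteSpace E] {K : E →L[ℝ] E}
    (hK : ∀ x, ⟪K x, x⟫ ≤ 0) {T : ℝ} (hT : 0 ≤ T)
    (y : E) : ∃ D : C(Icc (0 : ℝ) T, E), D ⟨0, left_mem_Icc.2 hT⟩ = K y ∧
      ∀ t (ht : t ∈ Icc 0 T), ∫ s in (0 : ℝ)..t, IccExtend hT D s = K (D ⟨t, ht⟩ - K y) := by
  set ε : ℕ → ℝ := fun n => 1 / ((n : ℝ) + 1)
  have hε : ∀ n, 0 < ε n := fun n => by positivity
  have hε0 : Filter.Tendsto ε Filter.atTop (nhds 0) := tendsto_one_div_add_atTop_nhds_zero_nat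
  choose V hVc hV0 hVb hV' using fun n => exists_regularized hK (hε n) y
  let D : ℕ → C(Icc (0 : ℝ) T, E) := fun n =>
    ⟨fun t => K (V n t) - ε n • V n t, by have := hVc n; fun_prop⟩
  have hcauchy : CauchySeq D := by
    refine cauchySeq_of_le_tendsto_0
      (fun N => Real.sqrt (ε N ^ 2 * ‖y‖ ^ 2 + 8 * T * ε N * ‖y‖ ^ 2)) (fun n m N hn hm => ?_) ?_
    · rw [ContinuousMap.dist_le (Real.sqrt_nonneg _)]
      intro t
      rw [dist_eq_norm]
      refine Real.le_sqrt_of_sq_le ((norm_sub_sq_le_of_regularized hK (hε n) (hε m) (hV0 n) (hV0 m)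
        (hVb n) (hVb m) (hV' n) (hV' m) t.2.1).trans ?_)
      have mono : ∀ k, N ≤ k → ε k ≤ ε N := fun k hk => by
        have : (N : ℝ) ≤ k := by exact_mod_cast hk
        exact one_div_le_one_div_of_le (by positivity) (by linarith)
      have h1 := mono n hn
      have h2 := mono m hm
      have h3 : (ε n - ε m) ^ 2 ≤ ε N ^ 2 :=
        sq_le_sq' (by linarith [hε n, hε m]) (by linarith [hε n, hε m])
      have h4 : (t : ℝ) * (ε n + ε m) ≤ T * (2 * ε N) :=
        mul_le_mul t.2.2 (by linarith) (by linarith [hε n, hε m]) hT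
      nlinarith [sq_nonneg ‖y‖, mul_le_mul_of_nonneg_right h3 (sq_nonneg ‖y‖),
        mul_le_mul_of_nonneg_right h4 (sq_nonneg ‖y‖)]
    · have : Continuous fun e : ℝ => Real.sqrt (e ^ 2 * ‖y‖ ^ 2 + 8 * T * e * ‖y‖ ^ 2) := by
        fun_prop
      have h := (this.tendsto 0).comp hε0
      simpa [Function.comp_def] using h
  obtain ⟨D₀, hD₀⟩ := cauchySeq_tendsto_of_complete hcauchy
  have hpt : ∀ t, Filter.Tendsto (fun n => D n t) Filter.atTop (nhds (D₀ t)) := fun t =>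
    ((ContinuousEvalConst.continuous_eval_const t).tendsto D₀).comp hD₀
  have h0 : Filter.Tendsto (fun n => D n ⟨0, left_mem_Icc.2 hT⟩) Filter.atTop (nhds (K y)) := by
    have : ∀ n, D n ⟨0, left_mem_Icc.2 hT⟩ = K y - ε n • y := fun n => by
      change K (V n 0) - ε n • V n 0 = _
      rw [hV0]
    simp only [this]
    simpa using (tendsto_const_nhds (x := K y)).sub (hε0.smul_const y)
  refine ⟨D₀, tendsto_nhds_unique (hpt _) h0, fun t ht => ?_⟩
  have hl := ((continuous_integral_IccExtend (F := E) hT t).tendsto D₀).comp hD₀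
  have hd := (hpt ⟨t, ht⟩).sub h0
  have hr := ((K.continuous.tendsto _).comp hd).sub (hε0.smul hd)
  rw [zero_smul, sub_zero] at hr
  refine tendsto_nhds_unique hl (hr.congr fun n => ?_)
  have hi : IntervalIntegrable (V n) volume 0 t := (hVc n).intervalIntegrable _ _
  have hV : ∫ s in (0 : ℝ)..t, V n s = D n ⟨t, ht⟩ - D n ⟨0, left_mem_Icc.2 hT⟩ :=
    intervalIntegral.integral_eq_sub_of_hasDerivAt (fun s _ => hV' n s) hi
  have hK' := K.intervalIntegral_comp_comm hi
  rw [Function.comp_apply, Function.comp_apply, ← hV, ← hK', ← intervalIntegral.integral_smul,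
    ← intervalIntegral.integral_sub (Continuous.intervalIntegrable (by have := hVc n; fun_prop) _ _)
      (Continuous.intervalIntegrable (by have := hVc n; fun_prop) _ _)]
  refine intervalIntegral.integral_congr fun s hs => ?_
  rw [uIcc_of_le ht.1] at hs
  rw [IccExtend_of_mem hT _ ⟨hs.1, hs.2.trans ht.2⟩]
  rfl

/-- An injective dissipative operator has dense range. -/
theorem denseRange_of_dissipative [CompleteSpace E] {K : E →L[ℝ] E} (hK : ∀ x, ⟪K x, x⟫ ≤ 0)
    (hinj : ∀ x, K x = 0 → x = 0) : DenseRange K := by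
  have h : (LinearMap.range (K : E →ₗ[ℝ] E)).topologicalClosure = ⊤ := by
    rw [Submodule.topologicalClosure_eq_top_iff, Submodule.eq_bot_iff]
    intro y hy
    have hy' : ∀ x, ⟪K x, y⟫ = 0 := fun x => hy _ ⟨x, rfl⟩
    apply hinj
    -- `⟨K (y + εw), y + εw⟩ ≤ 0` for all `ε` gives `⟨K y, w⟩ ≤ 0`, in particular for `w = K y`
    have key : ∀ ε : ℝ, 0 < ε → ‖K y‖ ^ 2 + ε * ⟪K (K y), K y⟫ ≤ 0 := fun ε hε => by
      have := hK (y + ε • K y)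
      simp only [map_add, map_smul, inner_add_left, inner_add_right, real_inner_smul_left,
        inner_smul_right, hy', real_inner_self_eq_norm_sq] at this
      nlinarith
    have hlim : Filter.Tendsto (fun ε : ℝ => ‖K y‖ ^ 2 + ε * ⟪K (K y), K y⟫)
        (nhdsWithin 0 (Ioi 0)) (nhds (‖K y‖ ^ 2 + 0 * ⟪K (K y), K y⟫)) :=
      ((by fun_prop : Continuous fun ε : ℝ => ‖K y‖ ^ 2 + ε * ⟪K (K y), K y⟫).tendsto 0).mono_left
        nhdsWithin_le_nhds
    have hle := le_of_tendsto hlim (by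
      filter_upwards [self_mem_nhdsWithin] with ε hε using key ε hε)
    rw [zero_mul, add_zero] at hle
    exact norm_eq_zero.1 (pow_eq_zero_iff two_ne_zero |>.1 (le_antisymm hle (sq_nonneg _)))
  exact (Submodule.dense_iff_topologicalClosure_eq_top).2 h

end

/-! ### The weighted inner product of `H` -/

section

variable {L h α β : ℝ}

/-- The state space with its weighted Hilbert norm: `(w,z) ↦ (w, √(βh) z)` identifies `H` with a
Hilbert space whose squared norm is `normSqH`. -/
def toEnergy (L : ℝ) {h β : ℝ} (hβh : 0 < β * h) : H L ≃L[ℝ] WithLp 2 (X0 L × L2 1) :=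
  ((ContinuousLinearEquiv.refl ℝ (X0 L)).prodCongr
    (ContinuousLinearEquiv.smulLeft (Units.mk0 (Real.sqrt (β * h))
      (Real.sqrt_pos.2 hβh).ne'))).trans
    (WithLp.prodContinuousLinearEquiv 2 ℝ (X0 L) (L2 1)).symm

theorem inner_toEnergy (hβh : 0 < β * h) (U V : H L) :
    ⟪toEnergy L hβh U, toEnergy L hβh V⟫ =
      ⟪U.1.fst, V.1.fst⟫ + ⟪U.1.snd, V.1.snd⟫ + β * h * ⟪U.2, V.2⟫ := by
  rw [WithLp.prod_inner_apply]
  change ⟪U.1, V.1⟫ + ⟪Real.sqrt (β * h) • U.2, Real.sqrt (β * h) • V.2⟫ = _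
  rw [WithLp.prod_inner_apply, real_inner_smul_left, inner_smul_right, ← mul_assoc,
    Real.mul_self_sqrt hβh.le]
  rfl

theorem norm_toEnergy_sq (hβh : 0 < β * h) (U : H L) : ‖toEnergy L hβh U‖ ^ 2 = normSqH h β U := by
  rw [← real_inner_self_eq_norm_sq, inner_toEnergy, normSqH, WithLp.prod_norm_sq_eq_of_L2]
  simp only [real_inner_self_eq_norm_sq]

/-- The inverse of `A` on the state space with the weighted Hilbert norm. -/
def invAEnergy (α : ℝ) (hβh : 0 < β * h) :
    WithLp 2 (X0 L × L2 1) →L[ℝ] WithLp 2 (X0 L × L2 1) :=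
  (toEnergy L hβh : H L →L[ℝ] WithLp 2 (X0 L × L2 1)).comp ((invA L h α β).comp
    ((toEnergy L hβh).symm : WithLp 2 (X0 L × L2 1) →L[ℝ] H L))

theorem invAEnergy_toEnergy (hβh : 0 < β * h) (F : H L) :
    invAEnergy α hβh (toEnergy L hβh F) = toEnergy L hβh (invA L h α β F) := by
  change toEnergy L hβh (invA L h α β ((toEnergy L hβh).symm (toEnergy L hβh F))) = _
  rw [ContinuousLinearEquiv.symm_apply_apply]

theorem invAEnergy_dissipative (hL : 0 < L) (hβ : 0 < β) (hβh : 0 < β * h)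
    (hgain : 2 * α ^ 2 + 3 / 2 * β < 1 / 2) (x : WithLp 2 (X0 L × L2 1)) :
    ⟪invAEnergy α hβh x, x⟫ ≤ 0 := by
  obtain ⟨F, rfl⟩ := (toEnergy L hβh).surjective x
  rw [invAEnergy_toEnergy, inner_toEnergy]
  exact inner_invA_nonpos hL hβ hgain F

theorem denseRange_invA (hL : 0 < L) (hh : 0 < h) (hβ : 0 < β)
    (hgain : 2 * α ^ 2 + 3 / 2 * β < 1 / 2) : DenseRange (invA L h α β) := by
  have hβh : 0 < β * h := mul_pos hβ hh
  have h1 := denseRange_of_dissipative (invAEnergy_dissipative (α := α) hL hβ hβh hgain)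
    (fun x hx => by
      obtain ⟨F, rfl⟩ := (toEnergy L hβh).surjective x
      rw [invAEnergy_toEnergy, map_eq_zero_iff _ (toEnergy L hβh).injective] at hx
      rw [eq_zero_of_invA_eq_zero hL hh hx, map_zero])
  have h3 := DenseRange.comp
    ((toEnergy L hβh).symm.surjective.denseRange.comp h1 (toEnergy L hβh).symm.continuous)
    (toEnergy L hβh).surjective.denseRange
    ((toEnergy L hβh).symm.continuous.comp (invAEnergy α hβh).continuous)
  convert! h3 using 1
  funext F
  rw [Function.comp_apply, Function.comp_apply, invAEnergy_toEnergy,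
    ContinuousLinearEquiv.symm_apply_apply]

/-- For initial data in `D(A)` there is a mild solution. -/
theorem exists_mild_of_mem_domain (hL : 0 < L) (hh : 0 < h) (hβ : 0 < β)
    (hgain : 2 * α ^ 2 + 3 / 2 * β < 1 / 2) {T : ℝ} (hT : 0 ≤ T) (F : H L) :
    ∃ D : C(Icc (0 : ℝ) T, H L), D ⟨0, left_mem_Icc.2 hT⟩ = invA L h α β F ∧
      ∀ t (ht : t ∈ Icc 0 T), ∫ s in (0 : ℝ)..t, IccExtend hT D s =
        invA L h α β (D ⟨t, ht⟩ - invA L h α β F) := by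
  have hβh : 0 < β * h := mul_pos hβ hh
  obtain ⟨D, hD0, hD⟩ := exists_mild_of_dissipative
    (invAEnergy_dissipative (α := α) hL hβ hβh hgain) hT (toEnergy L hβh F)
  refine ⟨((toEnergy L hβh).symm : C(WithLp 2 (X0 L × L2 1), H L)).comp D, ?_, fun t ht => ?_⟩
  · change (toEnergy L hβh).symm (D _) = _
    rw [hD0, invAEnergy_toEnergy, ContinuousLinearEquiv.symm_apply_apply]
  · have hi : IntervalIntegrable (IccExtend hT D) volume 0 t :=
      (D.continuous.Icc_extend' (h := hT)).intervalIntegrable _ _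
    have e := ((toEnergy L hβh).symm : WithLp 2 (X0 L × L2 1) →L[ℝ]
      H L).intervalIntegral_comp_comm hi
    refine Eq.trans e ?_
    rw [hD t ht]
    change (toEnergy L hβh).symm (toEnergy L hβh _) = _
    rw [ContinuousLinearEquiv.symm_apply_apply, map_sub, invAEnergy_toEnergy]
    simp

/-- The energy does not increase along solutions of `W = A⁻¹ W'`. -/
theorem normSqH_le (hL : 0 < L) (hh : 0 < h) (hβ : 0 < β)
    (hgain : 2 * α ^ 2 + 3 / 2 * β < 1 / 2) {T : ℝ} {V : ℝ → H L} (hV : Continuous V) {W₀ : H L}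
    (hW : ∀ t ∈ Icc 0 T, W₀ + ∫ s in (0 : ℝ)..t, V s = invA L h α β (V t)) {t : ℝ}
    (ht : t ∈ Icc 0 T) : normSqH h β (invA L h α β (V t)) ≤ normSqH h β W₀ := by
  have hβh : 0 < β * h := mul_pos hβ hh
  have key := norm_le_of_dissipative (invAEnergy_dissipative (α := α) hL hβ hβh hgain) (T := T)
    (v := fun t => toEnergy L hβh (V t)) (w₀ := toEnergy L hβh W₀)
    ((toEnergy L hβh).continuous.comp hV) (fun t ht => by
      rw [invAEnergy_toEnergy, ← hW t ht, map_add]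
      congr 1
      exact (toEnergy L hβh : H L →L[ℝ] WithLp 2 (X0 L × L2 1)).intervalIntegral_comp_comm
        (hV.intervalIntegrable _ _)) ht
  rw [invAEnergy_toEnergy] at key
  rw [← norm_toEnergy_sq hβh, ← norm_toEnergy_sq hβh]
  gcongr

theorem eq_zero_of_normSqH_nonpos (hβh : 0 < β * h) {U : H L} (hU : normSqH h β U ≤ 0) : U = 0 := by
  rw [← norm_toEnergy_sq hβh] at hU
  have := norm_eq_zero.1 (pow_eq_zero_iff two_ne_zero |>.1 (le_antisymm hU (sq_nonneg _)))
  exact (map_eq_zero_iff _ (toEnergy L hβh).injective).1 this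

/-! ### Estimates for classical solutions -/

theorem inner_mulX_eq (f : L2 L) : ⟪mulX L f, f⟫ = ∫ x in Ioo 0 L, x * f x ^ 2 := by
  rw [inner_L2_eq]
  refine integral_congr_ae ?_
  filter_upwards [coeFn_mulX f] with x hx
  rw [hx]; ring

theorem inner_mulX_nonneg (f : L2 L) : 0 ≤ ⟪mulX L f, f⟫ := by
  rw [inner_mulX_eq]
  exact setIntegral_nonneg measurableSet_Ioo fun x hx => mul_nonneg hx.1.le (sq_nonneg _)

theorem inner_mulX_le (f : L2 L) : ⟪mulX L f, f⟫ ≤ L * ‖f‖ ^ 2 := by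
  refine (real_inner_le_norm _ _).trans ?_
  have : ‖mulX L f‖ ≤ L * ‖f‖ := by
    refine Lp.norm_le_mul_norm_of_ae_le_mul ?_
    filter_upwards [coeFn_mulX f, ae_restrict_mem measurableSet_Ioo] with x hx hxa
    rw [hx, norm_mul, Real.norm_of_nonneg hxa.1.le]
    exact mul_le_mul_of_nonneg_right hxa.2.le (norm_nonneg _)
  nlinarith [norm_nonneg f]

variable {T : ℝ} {V : ℝ → H L} {W₀ : H L}

/-- `⟨N w, w⟩` for a component `w` of a solution of `W = A⁻¹ W'` and a symmetric operator `N`. -/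
theorem integral_component_eq_sub {F : Type*} [NormedAddCommGroup F] [InnerProductSpace ℝ F]
    (hT : 0 ≤ T) (hV : Continuous V)
    (hW : ∀ t ∈ Icc 0 T, W₀ + ∫ s in (0 : ℝ)..t, V s = invA L h α β (V t))
    (R : H L →L[ℝ] F) (N : F →L[ℝ] F) (hN : ∀ x y, ⟪x, N y⟫ = ⟪N x, y⟫) :
    ∫ s in (0 : ℝ)..T, 2 * ⟪N (R (invA L h α β (V s))), R (V s)⟫ =
      ⟪N (R (invA L h α β (V T))), R (invA L h α β (V T))⟫ - ⟪N (R W₀), R W₀⟫ := by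
  have hd : ∀ t, HasDerivAt (fun t => R (W₀ + ∫ s in (0 : ℝ)..t, V s)) (R (V t)) t := fun t =>
    R.hasFDerivAt.comp_hasDerivAt t (hasDerivAt_add_integral hV W₀ t)
  have e := integral_two_inner_eq_sub N hN (R.continuous.comp hV) hd T
  rw [hW T (right_mem_Icc.2 hT), intervalIntegral.integral_same, add_zero] at e
  rw [← e]
  refine intervalIntegral.integral_congr fun s hs => ?_
  rw [uIcc_of_le hT] at hs
  simp only [hW s hs, Function.comp_apply]

/-- The multiplier `1` for the first equation. -/
theorem integral_traceUx_sq_le (hL : 0 < L) (hT : 0 ≤ T) (hV : Continuous V)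
    (hW : ∀ t ∈ Icc 0 T, W₀ + ∫ s in (0 : ℝ)..t, V s = invA L h α β (V t)) :
    ∫ s in (0 : ℝ)..T, traceUx L (V s) ^ 2 ≤ 2 * ‖W₀.1.fst‖ ^ 2 := by
  have e := integral_component_eq_sub hT hV hW (projU L) (ContinuousLinearMap.id ℝ _)
    (fun _ _ => rfl)
  have e' : ∀ s, 2 * ⟪ContinuousLinearMap.id ℝ _ (projU L (invA L h α β (V s))), projU L (V s)⟫ =
      -(1 / 2) * traceUx L (V s) ^ 2 := fun s =>
    two_inner_invA_u (h := h) (α := α) (β := β) hL (V s)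
  simp only [e', intervalIntegral.integral_const_mul] at e
  simp only [ContinuousLinearMap.id_apply, real_inner_self_eq_norm_sq] at e
  have : ‖projU L W₀‖ = ‖W₀.1.fst‖ := rfl
  rw [← this]
  nlinarith [sq_nonneg ‖projU L (invA L h α β (V T))‖]

/-- The multiplier `1` for the transport equation. -/
theorem integral_traceZ_sq_le (hh : 0 < h) (hT : 0 ≤ T) (hV : Continuous V)
    (hW : ∀ t ∈ Icc 0 T, W₀ + ∫ s in (0 : ℝ)..t, V s = invA L h α β (V t)) :
    ∫ s in (0 : ℝ)..T, traceZ L h (V s) ^ 2 ≤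
      (∫ s in (0 : ℝ)..T, traceUx L (V s) ^ 2) + h * ‖W₀.2‖ ^ 2 := by
  have e := integral_component_eq_sub hT hV hW (projZ L) (ContinuousLinearMap.id ℝ _)
    (fun _ _ => rfl)
  have e' : ∀ s, 2 * ⟪ContinuousLinearMap.id ℝ _ (projZ L (invA L h α β (V s))), projZ L (V s)⟫ =
      h⁻¹ * (traceUx L (V s) ^ 2 - traceZ L h (V s) ^ 2) := fun s => by
    rw [← two_inner_invA_z (α := α) (β := β) (V s)]
    field_simp
    rfl
  have c1 : IntervalIntegrable (fun s => traceUx L (V s) ^ 2) volume 0 T :=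
    Continuous.intervalIntegrable (by fun_prop) _ _
  have c2 : IntervalIntegrable (fun s => traceZ L h (V s) ^ 2) volume 0 T :=
    Continuous.intervalIntegrable (by fun_prop) _ _
  simp only [e', intervalIntegral.integral_const_mul] at e
  rw [intervalIntegral.integral_sub c1 c2] at e
  simp only [ContinuousLinearMap.id_apply, real_inner_self_eq_norm_sq] at e
  have : ‖projZ L W₀‖ = ‖W₀.2‖ := rfl
  rw [← this]
  field_simp at e
  nlinarith [mul_nonneg hh.le (sq_nonneg ‖projZ L (invA L h α β (V T))‖)]

/-- The multiplier `L - x` for the first equation. -/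
theorem integral_solUx_sq_le (hL : 0 < L) (hT : 0 ≤ T) (hV : Continuous V)
    (hW : ∀ t ∈ Icc 0 T, W₀ + ∫ s in (0 : ℝ)..t, V s = invA L h α β (V t)) :
    3 / 2 * ∫ s in (0 : ℝ)..T, ‖solUx L (V s)‖ ^ 2 ≤ L * ‖W₀.1.fst‖ ^ 2 := by
  -- the multiplier `L - x` makes the boundary term at `L` disappear
  have e := integral_component_eq_sub hT hV hW (projU L)
    (L • ContinuousLinearMap.id ℝ (L2 L) - mulX L) (fun x y => by
      change ⟪x, L • y - mulX L y⟫ = ⟪L • x - mulX L x, y⟫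
      rw [inner_sub_right, inner_sub_left, mulX_inner_right, real_inner_smul_left,
        inner_smul_right])
  have e0 : ∀ x y : L2 L, ⟪(L • ContinuousLinearMap.id ℝ (L2 L) - mulX L) x, y⟫ =
      L * ⟪x, y⟫ - ⟪mulX L x, y⟫ := fun x y => by
    change ⟪L • x - mulX L x, y⟫ = _
    rw [inner_sub_left, real_inner_smul_left]
  have e' : ∀ s, 2 * ⟪(L • ContinuousLinearMap.id ℝ (L2 L) - mulX L)
      (projU L (invA L h α β (V s))), projU L (V s)⟫ = -(3 / 2) * ‖solUx L (V s)‖ ^ 2 := fun s => by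
    have h1 := two_inner_invA_u (h := h) (α := α) (β := β) hL (V s)
    have h2 := two_inner_mulX_invA_u (h := h) (α := α) (β := β) hL (V s)
    rw [e0]
    change 2 * (L * ⟪(invA L h α β (V s)).1.fst, (V s).1.fst⟫ -
      ⟪mulX L (invA L h α β (V s)).1.fst, (V s).1.fst⟫) = _
    linear_combination L * h1 - h2
  simp only [e', intervalIntegral.integral_const_mul] at e
  rw [e0, e0, real_inner_self_eq_norm_sq, real_inner_self_eq_norm_sq] at e
  have : ‖projU L W₀‖ = ‖W₀.1.fst‖ := rfl
  rw [← this]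
  have i1 := inner_mulX_le (projU L (invA L h α β (V T)))
  have i2 := inner_mulX_nonneg (projU L W₀)
  linarith

/-- The multiplier `x` for the second equation. -/
theorem integral_solVx_sq_le (hL : 0 < L) (hT : 0 ≤ T) (hV : Continuous V)
    (hW : ∀ t ∈ Icc 0 T, W₀ + ∫ s in (0 : ℝ)..t, V s = invA L h α β (V t)) :
    3 * ∫ s in (0 : ℝ)..T, ‖solVx L h α β (V s)‖ ^ 2 ≤
      L * (∫ s in (0 : ℝ)..T, traceVx L h α β (V s) ^ 2) + L * ‖W₀.1.snd‖ ^ 2 := by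
  have e := integral_component_eq_sub hT hV hW (projV L) (mulX L) mulX_inner_right
  have e' : ∀ s, 2 * ⟪mulX L (projV L (invA L h α β (V s))), projV L (V s)⟫ =
      L * traceVx L h α β (V s) ^ 2 - 3 * ‖solVx L h α β (V s)‖ ^ 2 := fun s =>
    two_inner_mulX_invA_v hL (V s)
  have c1 : IntervalIntegrable (fun s => L * traceVx L h α β (V s) ^ 2) volume 0 T :=
    Continuous.intervalIntegrable (by fun_prop) _ _
  have c2 : IntervalIntegrable (fun s => 3 * ‖solVx L h α β (V s)‖ ^ 2) volume 0 T :=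
    Continuous.intervalIntegrable (by fun_prop) _ _
  simp only [e'] at e
  rw [intervalIntegral.integral_sub c1 c2, intervalIntegral.integral_const_mul,
    intervalIntegral.integral_const_mul] at e
  have : ‖projV L W₀‖ = ‖W₀.1.snd‖ := rfl
  rw [← this]
  have i1 := inner_mulX_nonneg (projV L (invA L h α β (V T)))
  have i2 := inner_mulX_le (projV L W₀)
  linarith

theorem integral_traceVx_sq_le (hT : 0 ≤ T) (hV : Continuous V) :
    ∫ s in (0 : ℝ)..T, traceVx L h α β (V s) ^ 2 ≤
      2 * α ^ 2 * (∫ s in (0 : ℝ)..T, traceUx L (V s) ^ 2) +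
        2 * β ^ 2 * ∫ s in (0 : ℝ)..T, traceZ L h (V s) ^ 2 := by
  rw [← intervalIntegral.integral_const_mul, ← intervalIntegral.integral_const_mul,
    ← intervalIntegral.integral_add (Continuous.intervalIntegrable (by fun_prop) _ _)
      (Continuous.intervalIntegrable (by fun_prop) _ _)]
  refine intervalIntegral.integral_mono_on hT (Continuous.intervalIntegrable (by fun_prop) _ _)
    (Continuous.intervalIntegrable (by fun_prop) _ _) fun s _ => ?_
  rw [traceVx_apply]
  nlinarith [sq_nonneg (α * traceUx L (V s) - β * traceZ L h (V s))]

theorem integral_traces_le (hL : 0 < L) (hh : 0 < h) (hT : 0 ≤ T) (hV : Continuous V)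
    (hW : ∀ t ∈ Icc 0 T, W₀ + ∫ s in (0 : ℝ)..t, V s = invA L h α β (V t)) :
    (∫ s in (0 : ℝ)..T, traceUx L (V s) ^ 2) + ∫ s in (0 : ℝ)..T, traceZ L h (V s) ^ 2 ≤
      4 * ‖W₀.1‖ ^ 2 + h * ‖W₀.2‖ ^ 2 := by
  have h1 := integral_traceUx_sq_le hL hT hV hW
  have h2 := integral_traceZ_sq_le hh hT hV hW
  rw [WithLp.prod_norm_sq_eq_of_L2]
  nlinarith [sq_nonneg ‖W₀.1.snd‖]

/-- The Kato smoothing estimate for classical solutions. -/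
theorem integral_solDx_sq_le (hL : 0 < L) (hh : 0 < h) (hβ : 0 < β)
    (hgain : 2 * α ^ 2 + 3 / 2 * β < 1 / 2) (hT : 0 ≤ T) (hV : Continuous V)
    (hW : ∀ t ∈ Icc 0 T, W₀ + ∫ s in (0 : ℝ)..t, V s = invA L h α β (V t)) :
    ∫ s in (0 : ℝ)..T, ‖solDx L h α β (V s)‖ ^ 2 ≤
      4 / 3 * L * (1 + α ^ 2 + β ^ 2) * normSqH h β W₀ := by
  have h1 := integral_traceUx_sq_le hL hT hV hW
  have h2 := integral_traceZ_sq_le hh hT hV hW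
  have h3 := integral_solUx_sq_le hL hT hV hW
  have h4 := integral_solVx_sq_le hL hT hV hW
  have h5 := integral_traceVx_sq_le (h := h) (α := α) (β := β) hT hV
  have e : ∫ s in (0 : ℝ)..T, ‖solDx L h α β (V s)‖ ^ 2 =
      (∫ s in (0 : ℝ)..T, ‖solUx L (V s)‖ ^ 2) + ∫ s in (0 : ℝ)..T, ‖solVx L h α β (V s)‖ ^ 2 := by
    rw [← intervalIntegral.integral_add (Continuous.intervalIntegrable (by fun_prop) _ _)
      (Continuous.intervalIntegrable (by fun_prop) _ _)]
    refine intervalIntegral.integral_congr fun s _ => ?_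
    rw [WithLp.prod_norm_sq_eq_of_L2, solDx_fst, solDx_snd]
  rw [e, normSqH, WithLp.prod_norm_sq_eq_of_L2]
  set P := ∫ s in (0 : ℝ)..T, traceUx L (V s) ^ 2
  set Q := ∫ s in (0 : ℝ)..T, traceZ L h (V s) ^ 2
  set R := ∫ s in (0 : ℝ)..T, traceVx L h α β (V s) ^ 2
  set X := ∫ s in (0 : ℝ)..T, ‖solUx L (V s)‖ ^ 2
  set Y := ∫ s in (0 : ℝ)..T, ‖solVx L h α β (V s)‖ ^ 2
  have hu : 0 ≤ ‖W₀.1.fst‖ ^ 2 := sq_nonneg _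
  have hv : 0 ≤ ‖W₀.1.snd‖ ^ 2 := sq_nonneg _
  have hz : 0 ≤ h * ‖W₀.2‖ ^ 2 := mul_nonneg hh.le (sq_nonneg _)
  have hβ' : β < 1 / 3 := by nlinarith [sq_nonneg α]
  have k1 : R ≤ 4 * (α ^ 2 + β ^ 2) * ‖W₀.1.fst‖ ^ 2 + 2 * β ^ 2 * (h * ‖W₀.2‖ ^ 2) := by
    have m1 := mul_le_mul_of_nonneg_left h1 (sq_nonneg α)
    have m2 := mul_le_mul_of_nonneg_left (h2.trans (add_le_add_left h1 _)) (sq_nonneg β)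
    linarith
  have k2 := mul_le_mul_of_nonneg_left k1 hL.le
  have k3 : 0 ≤ L * ((α ^ 2 + β ^ 2) * ‖W₀.1.snd‖ ^ 2) := by positivity
  have k4 : 0 ≤ L * ((α ^ 2 + β ^ 2) * (β * (h * ‖W₀.2‖ ^ 2))) := by positivity
  have k5 : L * (β ^ 2 * (h * ‖W₀.2‖ ^ 2)) ≤ L * (β * (h * ‖W₀.2‖ ^ 2)) :=
    mul_le_mul_of_nonneg_left (mul_le_mul_of_nonneg_right (by nlinarith) hz) hL.le
  have k6 : 0 ≤ L * (β * (h * ‖W₀.2‖ ^ 2)) := by positivity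
  have k7 := mul_nonneg hL.le hu
  have k8 := mul_nonneg hL.le hv
  nlinarith

end

/-! ### The space of solutions -/

/-- The space of the data `(U, u_x(·,L), z(·,1), (u_x,v_x))` that belong to a solution. -/
abbrev SolData (L T : ℝ) : Type :=
  C(Icc (0 : ℝ) T, H L) × L2 T × L2 T × Lp (X0 L) 2 (volume.restrict (Ioo (0 : ℝ) T))

section

variable {L T h α β : ℝ}

/-- `V` is the time derivative of a classical solution `U` with data `Y`, so that `U = A⁻¹ V`, and
the traces and spatial derivatives are images of `V` under bounded operators. -/
structure IsClassical (h α β : ℝ) (Y : SolData L T) (V : ℝ → H L) : Prop where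
  continuous : Continuous V
  path_eq : ∀ t (ht : t ∈ Icc 0 T), Y.1 ⟨t, ht⟩ = invA L h α β (V t)
  integral_eq : ∀ t ∈ Icc 0 T,
    invA L h α β (V 0) + ∫ s in (0 : ℝ)..t, V s = invA L h α β (V t)
  traceUx_eq : (Y.2.1 : ℝ → ℝ) =ᵐ[volume.restrict (Ioo (0 : ℝ) T)] fun t => traceUx L (V t)
  traceZ_eq : (Y.2.2.1 : ℝ → ℝ) =ᵐ[volume.restrict (Ioo (0 : ℝ) T)] fun t => traceZ L h (V t)
  dx_eq : (Y.2.2.2 : ℝ → X0 L) =ᵐ[volume.restrict (Ioo (0 : ℝ) T)] fun t => solDx L h α β (V t)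

/-- The space of classical solutions. -/
def classicalSolutions (L T h α β : ℝ) : Submodule ℝ (SolData L T) where
  carrier := {Y | ∃ V, IsClassical h α β Y V}
  zero_mem' := by
    refine ⟨fun _ => 0, continuous_const, fun t ht => by simp, fun t ht => by simp, ?_, ?_, ?_⟩
    · filter_upwards [Lp.coeFn_zero ℝ 2 (volume.restrict (Ioo (0 : ℝ) T))] with t ht
      rw [map_zero]; exact ht
    · filter_upwards [Lp.coeFn_zero ℝ 2 (volume.restrict (Ioo (0 : ℝ) T))] with t ht
      rw [map_zero]; exact ht
    · filter_upwards [Lp.coeFn_zero (X0 L) 2 (volume.restrict (Ioo (0 : ℝ) T))] with t ht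
      rw [map_zero]; exact ht
  add_mem' := by
    rintro Y Y' ⟨V, hV⟩ ⟨V', hV'⟩
    refine ⟨fun t => V t + V' t, hV.continuous.add hV'.continuous, fun t ht => ?_, fun t ht => ?_,
      ?_, ?_, ?_⟩
    · rw [map_add, ← hV.path_eq t ht, ← hV'.path_eq t ht]; rfl
    · rw [map_add, map_add, ← hV.integral_eq t ht, ← hV'.integral_eq t ht,
        intervalIntegral.integral_add (hV.continuous.intervalIntegrable _ _)
          (hV'.continuous.intervalIntegrable _ _)]
      abel
    · filter_upwards [Lp.coeFn_add Y.2.1 Y'.2.1, hV.traceUx_eq, hV'.traceUx_eq] with t h1 h2 h3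
      rw [map_add, ← h2, ← h3]; exact h1
    · filter_upwards [Lp.coeFn_add Y.2.2.1 Y'.2.2.1, hV.traceZ_eq, hV'.traceZ_eq] with t h1 h2 h3
      rw [map_add, ← h2, ← h3]; exact h1
    · filter_upwards [Lp.coeFn_add Y.2.2.2 Y'.2.2.2, hV.dx_eq, hV'.dx_eq] with t h1 h2 h3
      rw [map_add, ← h2, ← h3]; exact h1
  smul_mem' := by
    rintro c Y ⟨V, hV⟩
    refine ⟨fun t => c • V t, hV.continuous.const_smul c, fun t ht => ?_, fun t ht => ?_,
      ?_, ?_, ?_⟩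
    · rw [map_smul, ← hV.path_eq t ht]; rfl
    · rw [map_smul, map_smul, ← hV.integral_eq t ht, intervalIntegral.integral_smul, smul_add]
    · filter_upwards [Lp.coeFn_smul c Y.2.1, hV.traceUx_eq] with t h1 h2
      rw [map_smul, ← h2]; exact h1
    · filter_upwards [Lp.coeFn_smul c Y.2.2.1, hV.traceZ_eq] with t h1 h2
      rw [map_smul, ← h2]; exact h1
    · filter_upwards [Lp.coeFn_smul c Y.2.2.2, hV.dx_eq] with t h1 h2
      rw [map_smul, ← h2]; exact h1

/-- The solution space: the closure of the classical solutions. -/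
def solutions (L T h α β : ℝ) : Submodule ℝ (SolData L T) :=
  (classicalSolutions L T h α β).topologicalClosure

/-- Closed properties pass from classical solutions to all elements of the solution space. -/
theorem solutions_induction {p : SolData L T → Prop} (hp : IsClosed {Y | p Y})
    (hc : ∀ Y V, IsClassical h α β Y V → p Y) {Y : SolData L T}
    (hY : Y ∈ solutions L T h α β) : p Y := by
  have : (solutions L T h α β : Set (SolData L T)) ⊆ {Y | p Y} := by
    rw [solutions, Submodule.topologicalClosure_coe]
    exact closure_minimal (fun Y ⟨V, hV⟩ => hc Y V hV) hp
  exact this hY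

/-- The initial value of a solution. -/
def initial (hT : 0 ≤ T) (Y : SolData L T) : H L := Y.1 ⟨0, left_mem_Icc.2 hT⟩

theorem continuous_eval (t : Icc (0 : ℝ) T) : Continuous fun Y : SolData L T => Y.1 t :=
  (ContinuousEvalConst.continuous_eval_const t).comp continuous_fst

theorem continuous_initial (hT : 0 ≤ T) : Continuous (initial (L := L) hT) := continuous_eval _

theorem continuous_normSqH : Continuous fun U : H L => normSqH h β U := by
  unfold normSqH; fun_prop

theorem IsClassical.initial_eq (hT : 0 ≤ T) {Y : SolData L T} {V : ℝ → H L}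
    (hY : IsClassical h α β Y V) : initial hT Y = invA L h α β (V 0) :=
  hY.path_eq 0 _

theorem solution_normSqH_le (hL : 0 < L) (hT : 0 ≤ T) (hh : 0 < h) (hβ : 0 < β)
    (hgain : 2 * α ^ 2 + 3 / 2 * β < 1 / 2) {Y : SolData L T} (hY : Y ∈ solutions L T h α β)
    (t : Icc (0 : ℝ) T) : normSqH h β (Y.1 t) ≤ normSqH h β (initial hT Y) := by
  refine solutions_induction (p := fun Y => normSqH h β (Y.1 t) ≤ normSqH h β (initial hT Y))
    (isClosed_le (continuous_normSqH.comp (continuous_eval t))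
      (continuous_normSqH.comp (continuous_initial hT))) (fun Y V hV => ?_) hY
  rw [hV.initial_eq hT, hV.path_eq t t.2]
  exact normSqH_le hL hh hβ hgain hV.continuous hV.integral_eq t.2

theorem norm_sq_L2 (hT : 0 < T) {f : L2 T} {g : ℝ → ℝ}
    (hf : (f : ℝ → ℝ) =ᵐ[volume.restrict (Ioo (0 : ℝ) T)] g) :
    ‖f‖ ^ 2 = ∫ s in (0 : ℝ)..T, g s ^ 2 := by
  rw [← real_inner_self_eq_norm_sq, inner_eq_intervalIntegral hT]
  refine intervalIntegral_congr_ae_Ioo (right_mem_Icc.2 hT.le) ?_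
  filter_upwards [hf] with t ht
  rw [ht, sq]

theorem solution_traces_le (hL : 0 < L) (hT : 0 < T) (hh : 0 < h) {Y : SolData L T}
    (hY : Y ∈ solutions L T h α β) :
    ‖Y.2.1‖ ^ 2 + ‖Y.2.2.1‖ ^ 2 ≤
      4 * ‖(initial hT.le Y).1‖ ^ 2 + h * ‖(initial hT.le Y).2‖ ^ 2 := by
  refine solutions_induction (p := fun Y => ‖Y.2.1‖ ^ 2 + ‖Y.2.2.1‖ ^ 2 ≤
      4 * ‖(initial hT.le Y).1‖ ^ 2 + h * ‖(initial hT.le Y).2‖ ^ 2)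
    (isClosed_le (by fun_prop) ?_) (fun Y V hV => ?_) hY
  · have := continuous_initial (L := L) hT.le
    fun_prop
  · rw [norm_sq_L2 hT hV.traceUx_eq, norm_sq_L2 hT hV.traceZ_eq, hV.initial_eq]
    exact integral_traces_le hL hh hT.le hV.continuous hV.integral_eq

theorem solution_dx_le (hL : 0 < L) (hT : 0 < T) (hh : 0 < h) (hβ : 0 < β)
    (hgain : 2 * α ^ 2 + 3 / 2 * β < 1 / 2) {Y : SolData L T} (hY : Y ∈ solutions L T h α β) :
    ‖Y.2.2.2‖ ^ 2 ≤ 4 / 3 * L * (1 + α ^ 2 + β ^ 2) * normSqH h β (initial hT.le Y) := by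
  refine solutions_induction (p := fun Y => ‖Y.2.2.2‖ ^ 2 ≤
      4 / 3 * L * (1 + α ^ 2 + β ^ 2) * normSqH h β (initial hT.le Y))
    (isClosed_le (by fun_prop) (continuous_const.mul
      (continuous_normSqH.comp (continuous_initial hT.le)))) (fun Y V hV => ?_) hY
  rw [hV.initial_eq]
  refine le_trans (le_of_eq ?_)
    (integral_solDx_sq_le hL hh hβ hgain hT.le hV.continuous hV.integral_eq)
  rw [← real_inner_self_eq_norm_sq, L2.inner_def, intervalIntegral.integral_of_le hT.le,
    integral_Ioc_eq_integral_Ioo]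
  refine integral_congr_ae ?_
  filter_upwards [hV.dx_eq] with t ht
  rw [ht, real_inner_self_eq_norm_sq]

/-- Elements of the solution space solve the equation in the mild sense. -/
theorem solution_mild (hT : 0 ≤ T) {Y : SolData L T} (hY : Y ∈ solutions L T h α β) {t : ℝ}
    (ht : t ∈ Icc 0 T) : ∫ s in (0 : ℝ)..t, IccExtend hT Y.1 s =
      invA L h α β (Y.1 ⟨t, ht⟩ - initial hT Y) := by
  refine solutions_induction (p := fun Y => ∫ s in (0 : ℝ)..t, IccExtend hT Y.1 s =
      invA L h α β (Y.1 ⟨t, ht⟩ - initial hT Y))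
    (isClosed_eq ((continuous_integral_IccExtend hT t).comp continuous_fst)
      ((invA L h α β).continuous.comp ((continuous_eval _).sub (continuous_initial hT))))
    (fun Y V hV => ?_) hY
  rw [hV.initial_eq, hV.path_eq, ← hV.integral_eq t ht, add_sub_cancel_left,
    ← ContinuousLinearMap.intervalIntegral_comp_comm _ (hV.continuous.intervalIntegrable _ _)]
  refine intervalIntegral.integral_congr fun s hs => ?_
  rw [uIcc_of_le ht.1] at hs
  have hs' : s ∈ Icc 0 T := ⟨hs.1, hs.2.trans ht.2⟩
  simp only [IccExtend_of_mem hT _ hs', hV.path_eq s hs']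

theorem solution_integral_traceUx (hT : 0 ≤ T) {Y : SolData L T}
    (hY : Y ∈ solutions L T h α β) {t : ℝ} (ht : t ∈ Icc 0 T) :
    ∫ s in (0 : ℝ)..t, Y.2.1 s = traceUx L (Y.1 ⟨t, ht⟩ - initial hT Y) := by
  rw [← integralTo_apply Y.2.1 ht]
  refine solutions_induction (p := fun Y => integralTo T t Y.2.1 =
      traceUx L (Y.1 ⟨t, ht⟩ - initial hT Y))
    (isClosed_eq (by fun_prop)
      ((traceUx L).continuous.comp ((continuous_eval _).sub (continuous_initial hT))))
    (fun Y V hV => ?_) hY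
  rw [hV.initial_eq, hV.path_eq, ← hV.integral_eq t ht, add_sub_cancel_left,
    ← ContinuousLinearMap.intervalIntegral_comp_comm _ (hV.continuous.intervalIntegrable _ _),
    integralTo_apply _ ht]
  exact intervalIntegral_congr_ae_Ioo ht hV.traceUx_eq

theorem solution_integral_traceZ (hT : 0 ≤ T) {Y : SolData L T}
    (hY : Y ∈ solutions L T h α β) {t : ℝ} (ht : t ∈ Icc 0 T) :
    ∫ s in (0 : ℝ)..t, Y.2.2.1 s = traceZ L h (Y.1 ⟨t, ht⟩ - initial hT Y) := by
  rw [← integralTo_apply Y.2.2.1 ht]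
  refine solutions_induction (p := fun Y => integralTo T t Y.2.2.1 =
      traceZ L h (Y.1 ⟨t, ht⟩ - initial hT Y))
    (isClosed_eq (by fun_prop)
      ((traceZ L h).continuous.comp ((continuous_eval _).sub (continuous_initial hT))))
    (fun Y V hV => ?_) hY
  rw [hV.initial_eq, hV.path_eq, ← hV.integral_eq t ht, add_sub_cancel_left,
    ← ContinuousLinearMap.intervalIntegral_comp_comm _ (hV.continuous.intervalIntegrable _ _),
    integralTo_apply _ ht]
  exact intervalIntegral_congr_ae_Ioo ht hV.traceZ_eq

/-- The weak derivative is a closed operator: its graph consists of the `(f,g)` for which `f`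
differs from the primitive of `g` by a constant. -/
theorem isClosed_hasWeakDeriv {a : ℝ} (ha : 0 < a) :
    IsClosed {x : L2 a × L2 a | HasWeakDeriv a x.1 x.2} := by
  have e : {x : L2 a × L2 a | HasWeakDeriv a x.1 x.2} =
      (fun x => x.1 - primitive a x.2) ⁻¹' (Submodule.span ℝ {one a} : Set (L2 a)) := by
    ext x
    rw [mem_preimage, SetLike.mem_coe, Submodule.mem_span_singleton]
    constructor
    · intro hx
      obtain ⟨c, hc⟩ := hx.exists_eq ha
      exact ⟨c, by rw [hc]; abel⟩
    · rintro ⟨c, hc⟩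
      have := HasWeakDeriv.primitive_add_const ha x.2 c
      rwa [hc, add_sub_cancel] at this
  rw [e]
  exact (Submodule.closed_of_finiteDimensional _).preimage (by fun_prop)

theorem solution_hasWeakDeriv (hL : 0 < L) {Y : SolData L T} (hY : Y ∈ solutions L T h α β) :
    ∀ᵐ t ∂(volume.restrict (Ioo (0 : ℝ) T)), ∀ ht : t ∈ Icc (0 : ℝ) T,
      HasWeakDeriv L (Y.1 ⟨t, ht⟩).1.fst (Y.2.2.2 t).fst ∧
      HasWeakDeriv L (Y.1 ⟨t, ht⟩).1.snd (Y.2.2.2 t).snd := by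
  refine solutions_induction (p := fun Y => ∀ᵐ t ∂(volume.restrict (Ioo (0 : ℝ) T)),
      ∀ ht : t ∈ Icc (0 : ℝ) T, HasWeakDeriv L (Y.1 ⟨t, ht⟩).1.fst (Y.2.2.2 t).fst ∧
      HasWeakDeriv L (Y.1 ⟨t, ht⟩).1.snd (Y.2.2.2 t).snd) ?_ (fun Y V hV => ?_) hY
  · refine IsSeqClosed.isClosed fun Y Y₀ hY hlim => ?_
    -- a subsequence of the derivatives converges a.e. in time
    have hdx : Filter.Tendsto (fun n => (Y n).2.2.2) Filter.atTop (nhds Y₀.2.2.2) :=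
      ((by fun_prop : Continuous fun Y : SolData L T => Y.2.2.2).tendsto Y₀).comp hlim
    obtain ⟨φ, hφ, hae⟩ := (tendstoInMeasure_of_tendsto_Lp hdx).exists_seq_tendsto_ae
    filter_upwards [hae, ae_all_iff.2 hY] with t h1 h2 ht
    have hpath : Filter.Tendsto (fun n => (Y (φ n)).1 ⟨t, ht⟩) Filter.atTop
        (nhds (Y₀.1 ⟨t, ht⟩)) :=
      ((continuous_eval _).tendsto Y₀).comp (hlim.comp hφ.tendsto_atTop)
    have p1 : Continuous fun x : H L × X0 L => ((x.1.1.fst, x.2.fst) : L2 L × L2 L) := by fun_prop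
    have p2 : Continuous fun x : H L × X0 L => ((x.1.1.snd, x.2.snd) : L2 L × L2 L) := by fun_prop
    exact ⟨(isClosed_hasWeakDeriv hL).mem_of_tendsto
        ((p1.tendsto _).comp (hpath.prodMk_nhds h1))
        (Filter.Eventually.of_forall fun n => (h2 (φ n) ht).1),
      (isClosed_hasWeakDeriv hL).mem_of_tendsto
        ((p2.tendsto _).comp (hpath.prodMk_nhds h1))
        (Filter.Eventually.of_forall fun n => (h2 (φ n) ht).2)⟩
  · filter_upwards [hV.dx_eq] with t h1 ht
    rw [h1, hV.path_eq]
    exact ⟨hasWeakDeriv_invA_u hL _, hasWeakDeriv_invA_v hL _⟩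

theorem integral_sq_add_sq_eq_inner (w : X0 L) :
    ∫ x in Ioo 0 L, (w.fst x ^ 2 + w.snd x ^ 2) = ⟪w, w⟫ := by
  rw [WithLp.prod_inner_apply]
  change _ = ⟪w.fst, w.fst⟫ + ⟪w.snd, w.snd⟫
  rw [inner_L2_eq, inner_L2_eq, integral_add (Lp.memLp w.fst).integrable_sq
    (Lp.memLp w.snd).integrable_sq]
  simp only [sq]

theorem memLp_clm_IccExtend {F : Type*} [NormedAddCommGroup F] [NormedSpace ℝ F] (hT : 0 ≤ T)
    (R : H L →L[ℝ] F) (D : C(Icc (0 : ℝ) T, H L)) :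
    MemLp (fun t => R (IccExtend hT D t)) 2 (volume.restrict (Ioo (0 : ℝ) T)) := by
  refine MemLp.of_bound (R.continuous.comp
    (D.continuous.Icc_extend' (h := hT))).aestronglyMeasurable (‖R‖ * ‖D‖) (ae_of_all _ fun t => ?_)
  exact (R.le_opNorm _).trans (mul_le_mul_of_nonneg_left (D.norm_coe_le_norm _) (norm_nonneg _))

/-- There is a classical solution for every initial value in `D(A²)`: it is `A⁻¹ D` for the mild
solution `D` with initial value in `D(A)`. -/
theorem exists_classical (hL : 0 < L) (hT : 0 ≤ T) (hh : 0 < h) (hβ : 0 < β)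
    (hgain : 2 * α ^ 2 + 3 / 2 * β < 1 / 2) (F : H L) :
    ∃ Y ∈ classicalSolutions L T h α β,
      initial hT Y = invA L h α β (invA L h α β F) := by
  obtain ⟨D, hD0, hD⟩ := exists_mild_of_mem_domain (h := h) (α := α) hL hh hβ hgain hT F
  have h0 : IccExtend hT D 0 = invA L h α β F := by
    rw [IccExtend_of_mem hT _ (left_mem_Icc.2 hT), hD0]
  refine ⟨(⟨fun t => invA L h α β (D t), by fun_prop⟩,
    (memLp_clm_IccExtend hT (traceUx L) D).toLp _, (memLp_clm_IccExtend hT (traceZ L h) D).toLp _,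
    (memLp_clm_IccExtend hT (solDx L h α β) D).toLp _), ⟨IccExtend hT D,
      D.continuous.Icc_extend' (h := hT), fun t ht => ?_, fun t ht => ?_,
      (memLp_clm_IccExtend hT (traceUx L) D).coeFn_toLp,
      (memLp_clm_IccExtend hT (traceZ L h) D).coeFn_toLp,
      (memLp_clm_IccExtend hT (solDx L h α β) D).coeFn_toLp⟩, ?_⟩
  · rw [IccExtend_of_mem hT _ ht]; rfl
  · rw [h0, hD t ht, map_sub, IccExtend_of_mem hT _ ht, add_sub_cancel]
  · change invA L h α β (D _) = _
    rw [hD0]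

theorem norm_toEnergy_symm_le (hβh : 0 < β * h) {U W : H L} (hUW : normSqH h β U ≤ normSqH h β W) :
    ‖U‖ ≤ ‖((toEnergy L hβh).symm : WithLp 2 (X0 L × L2 1) →L[ℝ] H L)‖ *
      Real.sqrt (normSqH h β W) := by
  have h1 : U = ((toEnergy L hβh).symm : WithLp 2 (X0 L × L2 1) →L[ℝ] H L) (toEnergy L hβh U) :=
    ((toEnergy L hβh).symm_apply_apply U).symm
  nth_rw 1 [h1]
  refine (ContinuousLinearMap.le_opNorm _ _).trans (mul_le_mul_of_nonneg_left ?_ (norm_nonneg _))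
  refine Real.le_sqrt_of_sq_le ?_
  rwa [norm_toEnergy_sq]

/-- Solutions are bounded by their initial values. -/
theorem exists_norm_solution_le (hL : 0 < L) (hT : 0 < T) (hh : 0 < h) (hβ : 0 < β)
    (hgain : 2 * α ^ 2 + 3 / 2 * β < 1 / 2) : ∃ C : ℝ, 0 ≤ C ∧
      ∀ Y ∈ solutions L T h α β, ‖Y‖ ≤ C * ‖initial hT.le Y‖ := by
  have hβh : 0 < β * h := mul_pos hβ hh
  set c₁ := ‖((toEnergy L hβh).symm : WithLp 2 (X0 L × L2 1) →L[ℝ] H L)‖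
  set c₂ := Real.sqrt (4 + 1 / β)
  set c₃ := Real.sqrt (4 / 3 * L * (1 + α ^ 2 + β ^ 2))
  set c₄ := ‖(toEnergy L hβh : H L →L[ℝ] WithLp 2 (X0 L × L2 1))‖
  refine ⟨(c₁ + c₂ + c₃) * c₄, by positivity, fun Y hY => ?_⟩
  set W := initial hT.le Y
  have hW : Real.sqrt (normSqH h β W) ≤ c₄ * ‖W‖ := by
    rw [← norm_toEnergy_sq hβh, Real.sqrt_sq (norm_nonneg _)]
    exact ContinuousLinearMap.le_opNorm (toEnergy L hβh : H L →L[ℝ] WithLp 2 (X0 L × L2 1)) W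
  have hs := Real.sqrt_nonneg (normSqH h β W)
  have hc₁ : 0 ≤ c₁ := norm_nonneg _
  have hc₂ : 0 ≤ c₂ := Real.sqrt_nonneg _
  have hc₃ : 0 ≤ c₃ := Real.sqrt_nonneg _
  suffices hmain : ‖Y‖ ≤ (c₁ + c₂ + c₃) * Real.sqrt (normSqH h β W) by
    rw [mul_assoc]
    exact hmain.trans (mul_le_mul_of_nonneg_left hW (by positivity))
  have htr := solution_traces_le hL hT hh hY
  have htr' : 4 * ‖W.1‖ ^ 2 + h * ‖W.2‖ ^ 2 ≤ (4 + 1 / β) * normSqH h β W := by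
    have e : (4 + 1 / β) * normSqH h β W = 4 * ‖W.1‖ ^ 2 + h * ‖W.2‖ ^ 2 +
        (1 / β * ‖W.1‖ ^ 2 + 4 * (β * h * ‖W.2‖ ^ 2)) := by
      rw [normSqH]; field_simp; ring
    rw [e]
    have : 0 ≤ 1 / β * ‖W.1‖ ^ 2 + 4 * (β * h * ‖W.2‖ ^ 2) := by positivity
    linarith
  have b1 : ‖Y.1‖ ≤ c₁ * Real.sqrt (normSqH h β W) := by
    rw [ContinuousMap.norm_le _ (by positivity)]
    exact fun t => norm_toEnergy_symm_le hβh (solution_normSqH_le hL hT.le hh hβ hgain hY t)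
  have b2 : ‖Y.2.1‖ ≤ c₂ * Real.sqrt (normSqH h β W) := by
    rw [← Real.sqrt_mul (by positivity)]
    exact Real.le_sqrt_of_sq_le (by linarith [sq_nonneg ‖Y.2.2.1‖])
  have b3 : ‖Y.2.2.1‖ ≤ c₂ * Real.sqrt (normSqH h β W) := by
    rw [← Real.sqrt_mul (by positivity)]
    exact Real.le_sqrt_of_sq_le (by linarith [sq_nonneg ‖Y.2.1‖])
  have b4 : ‖Y.2.2.2‖ ≤ c₃ * Real.sqrt (normSqH h β W) := by
    rw [← Real.sqrt_mul (by positivity)]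
    exact Real.le_sqrt_of_sq_le (solution_dx_le hL hT hh hβ hgain hY)
  have m1 := mul_nonneg hc₁ hs
  have m2 := mul_nonneg hc₂ hs
  have m3 := mul_nonneg hc₃ hs
  rw [add_mul, add_mul]
  refine norm_prod_le_iff.2 ⟨by linarith, norm_prod_le_iff.2 ⟨by linarith,
    norm_prod_le_iff.2 ⟨by linarith, by linarith⟩⟩⟩

/-- The solution operator, with all the data of a solution. -/
theorem exists_solution_operator (hL : 0 < L) (hT : 0 < T) (hh : 0 < h) (hβ : 0 < β)
    (hgain : 2 * α ^ 2 + 3 / 2 * β < 1 / 2) : ∃ G : H L → SolData L T, Continuous G ∧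
      ∀ U₀, G U₀ ∈ solutions L T h α β ∧ initial hT.le (G U₀) = U₀ := by
  obtain ⟨C, hC, hbound⟩ := exists_norm_solution_le (h := h) (α := α) hL hT hh hβ hgain
  let f : solutions L T h α β → H L := fun Y => initial hT.le Y.1
  have hf : UniformContinuous f := by
    refine LipschitzWith.uniformContinuous (K := 1) (LipschitzWith.of_dist_le_mul fun Y Y' => ?_)
    rw [NNReal.coe_one, one_mul]
    exact (ContinuousMap.dist_apply_le_dist _).trans (le_max_left _ _)
  have hanti : AntilipschitzWith C.toNNReal f := by
    refine AntilipschitzWith.of_le_mul_dist fun Y Y' => ?_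
    have := hbound (Y - Y' : solutions L T h α β).1 (Y - Y').2
    rw [Real.coe_toNNReal C hC, dist_eq_norm (f Y)]
    change dist (Y : SolData L T) Y' ≤ _
    rw [dist_eq_norm]
    exact this
  have : CompleteSpace (solutions L T h α β) :=
    (Submodule.isClosed_topologicalClosure _).completeSpace_coe
  have hclosed : IsClosed (range f) := hanti.isClosed_range hf
  have hdense : Dense (range f) := by
    have hd := denseRange_invA (α := α) hL hh hβ hgain
    refine (hd.comp hd (invA L h α β).continuous).mono ?_
    rintro _ ⟨F, rfl⟩
    obtain ⟨Y, hY, hY0⟩ := exists_classical hL hT.le hh hβ hgain F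
    exact ⟨⟨Y, Submodule.le_topologicalClosure _ hY⟩, hY0⟩
  have hsurj : Function.Surjective f := by
    rw [← range_eq_univ, ← hclosed.closure_eq]
    exact hdense.closure_eq
  have hinv := Function.rightInverse_surjInv hsurj
  exact ⟨fun U₀ => (Function.surjInv hsurj U₀).1,
    continuous_subtype_val.comp (hanti.to_rightInverse hinv).continuous,
    fun U₀ => ⟨(Function.surjInv hsurj U₀).2, hinv U₀⟩⟩

/-- Uniqueness of mild solutions: the integral of the difference of two solutions has no energy. -/
theorem mild_unique (hL : 0 < L) (hT : 0 ≤ T) (hh : 0 < h) (hβ : 0 < β)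
    (hgain : 2 * α ^ 2 + 3 / 2 * β < 1 / 2) {U₀ : H L} {U W : C(Icc (0 : ℝ) T, H L)}
    (hU : IsMildSolution hT h α β U₀ U) (hW : IsMildSolution hT h α β U₀ W) : W = U := by
  have hUc : Continuous (IccExtend hT U) := U.continuous.Icc_extend' (h := hT)
  have hWc : Continuous (IccExtend hT W) := W.continuous.Icc_extend' (h := hT)
  ext1 t
  have e : ∀ t ∈ Icc 0 T, (0 : H L) + ∫ s in (0 : ℝ)..t, (IccExtend hT W s - IccExtend hT U s) =
      invA L h α β (IccExtend hT W t - IccExtend hT U t) := fun t ht => by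
    rw [zero_add, intervalIntegral.integral_sub (hWc.intervalIntegrable _ _)
      (hUc.intervalIntegrable _ _), eq_invA_of_isA hL hh (hU t ht),
      eq_invA_of_isA hL hh (hW t ht), ← map_sub, sub_sub_sub_cancel_right]
  have h1 := normSqH_le hL hh hβ hgain (hWc.sub hUc) e t.2
  have h2 := eq_zero_of_normSqH_nonpos (mul_pos hβ hh) (h1.trans (by simp [normSqH]))
  have h3 := eq_zero_of_invA_eq_zero hL hh h2
  rw [Pi.sub_apply, IccExtend_val, IccExtend_val] at h3
  exact sub_eq_zero.1 h3

end

end HirotaSatsuma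

end

theorem proposition2p3 (L T h α β : ℝ) (hL : 0 < L) (hT : 0 < T) (hh : 0 < h) (hβ : 0 < β)
    (hgain : 0 < 2 * α ^ 2 + 3 / 2 * β ∧ 2 * α ^ 2 + 3 / 2 * β < 1 / 2) :
    ∃ S : H L → BSpace L T × C(Icc (0 : ℝ) T, L2 1),
      Continuous S ∧
      ∀ U₀ : H L,
        -- `S U₀` is the unique mild solution
        IsMildSolution hT.le h α β U₀ ((S U₀).1.path.prodMk (S U₀).2) ∧
        (∀ W : C(Icc (0 : ℝ) T, H L), IsMildSolution hT.le h α β U₀ W →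
          W = (S U₀).1.path.prodMk (S U₀).2) ∧
        -- energy bound
        (∀ t : Icc (0 : ℝ) T,
          ‖(S U₀).1.path t‖ ^ 2 + β * h * ‖(S U₀).2 t‖ ^ 2 ≤ normSqH h β U₀) ∧
        -- bound on the boundary traces
        (∃ a b : Lp ℝ 2 (volume.restrict (Ioo (0 : ℝ) T)),
          IsTraceUx hT.le ((S U₀).1.path.prodMk (S U₀).2) a ∧
          IsTraceZ hT.le ((S U₀).1.path.prodMk (S U₀).2) b ∧
          ‖a‖ ^ 2 + ‖b‖ ^ 2 ≤ 4 * ‖U₀.1‖ ^ 2 + h * ‖U₀.2‖ ^ 2) ∧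
        -- Kato smoothing
        (∫ t in Ioo (0 : ℝ) T, ∫ x in Ioo (0 : ℝ) L,
            (((S U₀).1.dx t).fst x ^ 2 + ((S U₀).1.dx t).snd x ^ 2)) ≤
          4 / 3 * L * (1 + α ^ 2 + β ^ 2) * normSqH h β U₀ := by
  obtain ⟨G, hGc, hG⟩ := exists_solution_operator (h := h) (α := α) hL hT hh hβ hgain.2
  let fstC : C(H L, X0 L) := ⟨Prod.fst, continuous_fst⟩
  let sndC : C(H L, L2 1) := ⟨Prod.snd, continuous_snd⟩
  refine ⟨fun U₀ => (⟨(fstC.comp (G U₀).1, (G U₀).2.2.2), solution_hasWeakDeriv hL (hG U₀).1⟩,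
    sndC.comp (G U₀).1), ?_, fun U₀ => ?_⟩
  · refine Continuous.prodMk (Continuous.subtype_mk (Continuous.prodMk ?_ ?_) _) ?_
    · exact (ContinuousMap.continuous_postcomp fstC).comp (continuous_fst.comp hGc)
    · fun_prop
    · exact (ContinuousMap.continuous_postcomp sndC).comp (continuous_fst.comp hGc)
  obtain ⟨hY, h0⟩ := hG U₀
  have hmild := fun t (ht : t ∈ Icc 0 T) => solution_mild hT.le hY ht
  rw [h0] at hmild
  have hsol : IsMildSolution hT.le h α β U₀ (G U₀).1 := fun t ht => by
    rw [hmild t ht, IccExtend_of_mem hT.le _ ht]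
    exact isA_invA hL hh _
  refine ⟨hsol, fun W hW => mild_unique hL hT.le hh hβ hgain.2 hsol hW, fun t => ?_,
    ⟨(G U₀).2.1, (G U₀).2.2.1, fun t ht => ?_, fun t ht => ?_, ?_⟩, ?_⟩
  · have := solution_normSqH_le hL hT.le hh hβ hgain.2 hY t
    rwa [h0] at this
  · refine ⟨solUx L ((G U₀).1 ⟨t, ht⟩ - U₀), ?_, ?_⟩
    · change HasWeakDeriv L (∫ s in (0 : ℝ)..t, IccExtend hT.le (G U₀).1 s).1.fst _
      rw [hmild t ht]
      exact hasWeakDeriv_invA_u hL _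
    · rw [solution_integral_traceUx hT.le hY ht, h0]
      exact hasTrace_solUx _
  · change HasTrace 1 (∫ s in (0 : ℝ)..t, IccExtend hT.le (G U₀).1 s).2 1 _
    rw [hmild t ht, solution_integral_traceZ hT.le hY ht, h0]
    exact hasTrace_solZ _
  · have := solution_traces_le hL hT hh hY
    rwa [h0] at this
  · have key := solution_dx_le hL hT hh hβ hgain.2 hY
    rw [h0, ← real_inner_self_eq_norm_sq, L2.inner_def] at key
    refine le_trans (le_of_eq (integral_congr_ae (ae_of_all _ fun t => ?_))) key
    exact integral_sq_add_sq_eq_inner _
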